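/- There is a universal constant $C>0$ and, for every $0<\rho<1$, a constant $C(\rho)$ depending only on $\rho$ with $$C(\rho)\le C\,\max\{1,\log^2(1/\rho)\},$$ such that the following holds. Let $n\ge 1$ be an integer and $0<\rho<1$. Let $X_1,\dots,X_n$ be independent (not necessarily identically distributed) real random variables with finite fourth moments, $\mathbb E X_j=0$ and $\mathbb E X_j^2=1$ for all $j$, and put $\delta^4=\frac1n\sum_{j=1}^n\mathbb E X_j^4$. Let $\sigma_{n-1}$ be the uniform (rotation-invariant) probability measure on the unit sphere $S^{n-1}\subset\mathbb R^n$. Then there is a Borel set $\mathcal F\subseteq S^{n-1}$ with $\sigma_{n-1}(\mathcal F)\ge 1-\rho$ such that for every $\theta=(\theta_1,\dots,\theta_n)\in\mathcal F$, $$\sup_{\alpha<\beta}\left|\mathbb P\Big(\alpha\le\sum_{j=1}^n\theta_jX_j\le\beta\Big)-\frac1{\sqrt{2\pi}}\int_\alpha^\beta e^{-t^2/2}\,dt\right|\le\frac{C(\rho)\,\delta^4}{n}.$$ -/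

import Mathlib

open MeasureTheory ProbabilityTheory

/-- The unit sphere `S^{n-1}` of `ℝⁿ`, with the Euclidean norm. -/
abbrev UnitSphere (n : ℕ) : Type :=
  Metric.sphere (0 : EuclideanSpace ℝ (Fin n)) 1

/-- The uniform distribution `σ_{n-1}` on `S^{n-1}`, for `n ≥ 1`: the surface measure induced by
Lebesgue measure, normalized to total mass one. -/
noncomputable def sphereUniform (n : ℕ) : Measure (UnitSphere n) :=
  ((volume : Measure (EuclideanSpace ℝ (Fin n))).toSphere Set.univ)⁻¹ •
    (volume : Measure (EuclideanSpace ℝ (Fin n))).toSphere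

/-! Write `S` for the sum of the fourth moments and `U = n ^ 2 / S = n / δ ^ 4`; the target error is
a multiple of `L ^ 2 / U`, where `L = max 1 (log (1 / ρ))`. If `U < C * L ^ 2` the bound exceeds 1
and nothing is needed, so `U` may be taken large compared with `L ^ 2`.

The usual rate `n^(-1/2)` improves for typical `θ` for two reasons. First, the cubic term `∑ θ_j ^ 3
E X_j ^ 3` of the characteristic function has random signs: it has size about `√S / n ^ (3/2)`,
which is at most `S / n ^ 2 = 1 / U` because `n ≤ S`. Second, the characteristic function of the sum
is small up to frequency `U`, not merely up to `√U`, which excludes lattice effects at the scale `1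
/ √U`.

Esseen smoothing at frequency `T = U` (`exists_smoothing_inequality`) costs `1 / U` and leaves an
integral of `|φ(ξ) - exp(-ξ²/2)| / ξ` over `(0, U]`. Up to order `√U`,
`exists_lintegral_prod_charFun_sub_le` handles it: an Edgeworth-type expansion
(`norm_prod_charFun_sub_exp_le`) near zero, Gaussian decay (`norm_prod_charFun_le_exp`) further out.
From `√U` to `U` no pointwise bound is available, and one averages over `θ`. A Gaussian vector
replaces `θ`, so the average factorizes over the coordinates. The Gaussian mean of `|φ_j(s g)| ^ 2`
is nonincreasing in `|s|`, so the decay visible at small `s` persists at all larger ones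
(`exists_integral_norm_charFun_gaussian_le`). The product is then exponentially small in `U`, and
Markov's inequality finishes.

The remaining conditions of `IsRegularDirection` come from Gaussian tail bounds. High moments
control `∑ m_j g_j ^ 4` up to a factor `L ^ 2`. The cubic form has no exponential moments, so it is
treated by a self-normalized inequality for odd functions (`stdGaussianPi_odd_tail`), again with a
factor `L ^ 2`. -/

/-! ### Gaussian vectors and the uniform measure on the sphere -/

/-- The standard Gaussian measure on `ℝⁿ`. -/
noncomputable abbrev stdGaussianPi (n : ℕ) : Measure (Fin n → ℝ) :=
  Measure.pi fun _ => gaussianReal 0 1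

lemma stdGaussianPi_eq_withDensity (n : ℕ) :
    stdGaussianPi n =
      volume.withDensity fun g => ENNReal.ofReal (∏ i, gaussianPDFReal 0 1 (g i)) := by
  have hint : Integrable (fun g : Fin n → ℝ => ∏ i, gaussianPDFReal 0 1 (g i)) :=
    Integrable.fintype_prod (μ := fun _ => volume) fun _ => integrable_gaussianPDFReal 0 1
  refine Measure.pi_eq fun s hs => ?_
  rw [withDensity_apply _ (MeasurableSet.univ_pi hs),
    ← ofReal_integral_eq_lintegral_ofReal hint.integrableOn
      (Filter.Eventually.of_forall fun g => Finset.prod_nonneg fun i _ =>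
        gaussianPDFReal_nonneg 0 1 (g i)), volume_pi, Measure.restrict_pi_pi,
    integral_fintype_prod_eq_prod (fun _ => gaussianPDFReal 0 1),
    ENNReal.ofReal_prod_of_nonneg fun i _ =>
      integral_nonneg fun x => gaussianPDFReal_nonneg 0 1 x]
  exact Finset.prod_congr rfl fun i _ =>
    (gaussianReal_apply_eq_integral 0 one_ne_zero (s i)).symm

lemma prod_gaussianPDFReal_eq {n : ℕ} (x : EuclideanSpace ℝ (Fin n)) :
    ∏ i, gaussianPDFReal 0 1 (x i) =
      (√(2 * Real.pi))⁻¹ ^ n * Real.exp (-‖x‖ ^ 2 / 2) := by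
  simp only [gaussianPDFReal, Finset.prod_mul_distrib, Finset.prod_const, Finset.card_univ,
    Fintype.card_fin, ← Real.exp_sum, EuclideanSpace.real_norm_sq_eq]
  congr 2
  · simp
  · simp [← Finset.sum_div]

/-- The mass of a cone under the standard Gaussian measure, in polar coordinates. -/
lemma stdGaussianPi_cone {n : ℕ} {B : Set (UnitSphere n)} (hB : MeasurableSet B) :
    stdGaussianPi n (WithLp.toLp 2 ⁻¹' (Subtype.val ''
        (homeomorphUnitSphereProd (EuclideanSpace ℝ (Fin n)) ⁻¹' (B ×ˢ Set.univ)))) =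
      (volume : Measure (EuclideanSpace ℝ (Fin n))).toSphere B *
        ∫⁻ r : Set.Ioi (0 : ℝ), ENNReal.ofReal ((√(2 * Real.pi))⁻¹ ^ n *
          Real.exp (-(r : ℝ) ^ 2 / 2)) ∂(Measure.volumeIoiPow
            (Module.finrank ℝ (EuclideanSpace ℝ (Fin n)) - 1)) := by
  set f : ℝ → ENNReal := fun r => ENNReal.ofReal ((√(2 * Real.pi))⁻¹ ^ n *
    Real.exp (-r ^ 2 / 2)) with hf
  have hfm : Measurable f := by fun_prop
  set Φ := homeomorphUnitSphereProd (EuclideanSpace ℝ (Fin n))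
  have hS : MeasurableSet (Φ ⁻¹' (B ×ˢ Set.univ)) :=
    Φ.measurable (hB.prod MeasurableSet.univ)
  have hcompl : MeasurableSet ({0}ᶜ : Set (EuclideanSpace ℝ (Fin n))) :=
    (measurableSet_singleton _).compl
  have hA := (MeasurableEmbedding.subtype_coe hcompl).measurableSet_image.2 hS
  have hmp := PiLp.volume_preserving_toLp (Fin n)
  rw [stdGaussianPi_eq_withDensity, withDensity_apply _ (hmp.measurable hA)]
  have h1 : (fun g : Fin n → ℝ => ENNReal.ofReal (∏ i, gaussianPDFReal 0 1 (g i))) =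
      fun g => f ‖WithLp.toLp 2 g‖ := by
    funext g
    simp only [hf, ← prod_gaussianPDFReal_eq]
  rw [h1, hmp.setLIntegral_comp_preimage hA (f := fun x => f ‖x‖) (by fun_prop),
    ← setLIntegral_subtype hcompl _ (fun x : EuclideanSpace ℝ (Fin n) => f ‖x‖)]
  have hmp2 := (volume : Measure (EuclideanSpace ℝ (Fin n))).measurePreserving_homeomorphUnitSphereProd
  have h2 : ∀ x : ({0}ᶜ : Set (EuclideanSpace ℝ (Fin n))), f ‖x.1‖ = (fun p : UnitSphere n × Set.Ioi (0 : ℝ) =>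
    f p.2) (Φ x) := fun x => by simp [Φ]
  simp_rw [h2]
  rw [hmp2.setLIntegral_comp_preimage (hB.prod MeasurableSet.univ)
      (f := fun p : UnitSphere n × Set.Ioi (0 : ℝ) => f p.2) (by fun_prop),
    ← Measure.prod_restrict, Measure.restrict_univ]
  have := lintegral_prod_mul (μ := (volume : Measure (EuclideanSpace ℝ (Fin n))).toSphere.restrict B)
    (ν := Measure.volumeIoiPow (Module.finrank ℝ (EuclideanSpace ℝ (Fin n)) - 1))
    (f := fun _ => 1) (g := fun r => f r) (by fun_prop) (by fun_prop)
  simpa only [one_mul, lintegral_const, Measure.restrict_apply_univ] using this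

/-- The direction of a Gaussian vector is uniform, so `B` has the mass of the cone over it. Asking
only that `G` contain this cone, with an inequality as conclusion, spares any measurability of `G`.
-/
lemma sphereUniform_le_stdGaussianPi {n : ℕ} (hn : 1 ≤ n) {B : Set (UnitSphere n)}
    (hB : MeasurableSet B) {G : Set (Fin n → ℝ)}
    (h : ∀ g : Fin n → ℝ, ∀ θ ∈ B, 0 < ‖WithLp.toLp 2 g‖ →
      (∀ i, θ.1 i = g i / ‖WithLp.toLp 2 g‖) → g ∈ G) :
    sphereUniform n B ≤ stdGaussianPi n G := by
  have : Nonempty (Fin n) := ⟨⟨0, hn⟩⟩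
  have hcone := stdGaussianPi_cone hB
  have huniv := stdGaussianPi_cone (n := n) MeasurableSet.univ
  set I := ∫⁻ r : Set.Ioi (0 : ℝ), ENNReal.ofReal ((√(2 * Real.pi))⁻¹ ^ n *
          Real.exp (-(r : ℝ) ^ 2 / 2)) ∂(Measure.volumeIoiPow
            (Module.finrank ℝ (EuclideanSpace ℝ (Fin n)) - 1))
  have h1 : stdGaussianPi n (WithLp.toLp 2 ⁻¹' (Subtype.val ''
        (homeomorphUnitSphereProd (EuclideanSpace ℝ (Fin n)) ⁻¹' (Set.univ ×ˢ Set.univ)))) = 1 := by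
    have : (WithLp.toLp 2 ⁻¹' (Subtype.val ''
        (homeomorphUnitSphereProd (EuclideanSpace ℝ (Fin n)) ⁻¹' (Set.univ ×ˢ Set.univ))))
        = ({0}ᶜ : Set (Fin n → ℝ)) := by
      ext g
      simp
    rw [this, prob_compl_eq_one_iff (measurableSet_singleton _),
      stdGaussianPi_eq_withDensity]
    exact withDensity_absolutelyContinuous _ _ (measure_singleton _)
  -- The cone over the whole sphere has mass one, so the radial integral `I` is the inverse of the
  -- surface mass and never has to be computed.
  rw [h1] at huniv
  have hle : stdGaussianPi n (WithLp.toLp 2 ⁻¹' (Subtype.val ''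
        (homeomorphUnitSphereProd (EuclideanSpace ℝ (Fin n)) ⁻¹' (B ×ˢ Set.univ)))) ≤
      stdGaussianPi n G := by
    refine measure_mono fun g hg => ?_
    obtain ⟨x, hx, hxg⟩ := hg
    have hx0 : x.1 ≠ 0 := x.2
    refine h g _ hx.1 (by rw [← hxg]; exact norm_pos_iff.2 hx0) fun i => ?_
    rw [homeomorphUnitSphereProd_apply_fst_coe, hxg]
    simp [div_eq_inv_mul]
  rw [hcone] at hle
  refine le_trans (le_of_eq ?_) hle
  rw [sphereUniform, Measure.smul_apply, smul_eq_mul, mul_comm]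
  congr 1
  exact (ENNReal.eq_inv_of_mul_eq_one_left (by rw [mul_comm]; exact huniv.symm)).symm

instance isProbabilityMeasure_sphereUniform {n : ℕ} [NeZero n] :
    IsProbabilityMeasure (sphereUniform n) := by
  constructor
  have : Nonempty (Fin n) := ⟨0⟩
  rw [sphereUniform, Measure.smul_apply, smul_eq_mul]
  exact ENNReal.inv_mul_cancel (by
    rw [Ne, Measure.measure_univ_eq_zero]
    exact Measure.toSphere_ne_zero _) (measure_ne_top _ _)

/-! ### Esseen smoothing with the Fejér kernel -/

/-- The Fejér kernel `(1 - cos y) / y²`, as the Fourier transform of a triangle. -/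
noncomputable def fejerKernel (y : ℝ) : ℝ := ∫ t in (0 : ℝ)..1, (1 - t) * Real.cos (t * y)

lemma continuous_fejerKernel : Continuous fejerKernel :=
  intervalIntegral.continuous_parametric_intervalIntegral_of_continuous'
    (by unfold Function.uncurry; fun_prop) _ _

lemma fejerKernel_eq {y : ℝ} (hy : y ≠ 0) : fejerKernel y = (1 - Real.cos y) / y ^ 2 := by
  have h : ∀ t ∈ Set.uIcc (0 : ℝ) 1, HasDerivAt
      (fun t => (1 - t) * Real.sin (t * y) / y - Real.cos (t * y) / y ^ 2)
      ((1 - t) * Real.cos (t * y)) t := by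
    intro t _
    have h1 : HasDerivAt (fun t : ℝ => t * y) y t := by simpa using (hasDerivAt_id t).mul_const y
    have h2 : HasDerivAt (fun t : ℝ => 1 - t) (-1) t := by
      simpa using (hasDerivAt_id t).const_sub 1
    have := ((h2.mul h1.sin).div_const y).sub (h1.cos.div_const (y ^ 2))
    refine this.congr_deriv ?_
    field_simp
    ring
  rw [fejerKernel, intervalIntegral.integral_eq_sub_of_hasDerivAt h
    (by apply Continuous.intervalIntegrable; fun_prop)]
  simp
  ring

lemma fejerKernel_zero : fejerKernel 0 = 1 / 2 := by
  have h : ∀ t ∈ Set.uIcc (0 : ℝ) 1, HasDerivAt (fun t : ℝ => t - t ^ 2 / 2) (1 - t) t := by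
    intro t _
    have := (hasDerivAt_id' t).sub ((hasDerivAt_pow 2 t).div_const 2)
    simp only [Nat.cast_ofNat] at this
    refine this.congr_deriv ?_
    ring
  simp only [fejerKernel, mul_zero, Real.cos_zero, mul_one]
  rw [intervalIntegral.integral_eq_sub_of_hasDerivAt h
    (by apply Continuous.intervalIntegrable; fun_prop)]
  norm_num

lemma fejerKernel_nonneg (y : ℝ) : 0 ≤ fejerKernel y := by
  rcases eq_or_ne y 0 with rfl | hy
  · rw [fejerKernel_zero]; norm_num
  · rw [fejerKernel_eq hy]
    have := Real.cos_le_one y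
    positivity [sub_nonneg.2 this]

lemma fejerKernel_le (y : ℝ) : fejerKernel y ≤ 4 * (1 + y ^ 2)⁻¹ := by
  rcases eq_or_ne y 0 with rfl | hy
  · rw [fejerKernel_zero]; norm_num
  · rw [fejerKernel_eq hy, ← div_eq_mul_inv, div_le_div_iff₀ (by positivity) (by positivity)]
    have h1 := Real.one_sub_sq_div_two_le_cos (x := y)
    have h2 := Real.neg_one_le_cos y
    nlinarith [sq_nonneg y]

lemma integrable_fejerKernel : Integrable fejerKernel :=
  (integrable_inv_one_add_sq.const_mul 4).mono' continuous_fejerKernel.aestronglyMeasurable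
    (Filter.Eventually.of_forall fun y => by
      rw [Real.norm_of_nonneg (fejerKernel_nonneg y)]; exact fejerKernel_le y)

lemma integral_fejerKernel_pos : 0 < ∫ y, fejerKernel y := by
  rw [integral_pos_iff_support_of_nonneg fejerKernel_nonneg integrable_fejerKernel]
  exact (continuous_fejerKernel.isOpen_support).measure_pos _
    ⟨0, by simp [fejerKernel_zero]⟩

/-- With three quarters of the mass in the window, the outer part contributes only a third of the
supremum in the smoothing argument, which can be absorbed. -/
lemma exists_fejerKernel_tail : ∃ h : ℝ, 0 < h ∧
    3 / 4 * ∫ y, fejerKernel y ≤ ∫ y in Set.Icc (-h) h, fejerKernel y := by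
  have ht := intervalIntegral_tendsto_integral integrable_fejerKernel
    Filter.tendsto_neg_atTop_atBot Filter.tendsto_id
  have hp := integral_fejerKernel_pos
  obtain ⟨h, h1, h2⟩ := ((ht.eventually (lt_mem_nhds
    (by linarith : 3 / 4 * ∫ y, fejerKernel y < ∫ y, fejerKernel y))).and
    (Filter.eventually_gt_atTop 0)).exists
  refine ⟨h, h2, ?_⟩
  rw [intervalIntegral.integral_of_le (by simp; linarith), ← integral_Icc_eq_integral_Ioc] at h1
  exact h1.le

lemma integral_fejerKernel_interval (p q : ℝ) :
    ∫ z in p..q, fejerKernel z =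
      ∫ t in (0 : ℝ)..1, (1 - t) * ∫ z in p..q, Real.cos (t * z) := by
  simp only [fejerKernel, ← intervalIntegral.integral_const_mul]
  refine intervalIntegral_intervalIntegral_swap ?_
  refine IntegrableOn.mono_set (t := Set.uIcc p q ×ˢ Set.uIcc 0 1) ?_
    (Set.prod_mono Set.uIoc_subset_uIcc Set.uIoc_subset_uIcc)
  refine ContinuousOn.integrableOn_compact (isCompact_uIcc.prod isCompact_uIcc) ?_
  unfold Function.uncurry
  fun_prop

lemma integral_fejerKernel_mul_measureReal (ν : Measure ℝ) [IsProbabilityMeasure ν] {T a b : ℝ}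
    (hT : 0 < T) (hab : a ≤ b) :
    ∫ z, fejerKernel z * ν.real (Set.Icc (a + z / T) (b + z / T)) =
      ∫ x, (∫ z in T * (x - b)..T * (x - a), fejerKernel z) ∂ν := by
  have hset : MeasurableSet {p : ℝ × ℝ | a + p.1 / T ≤ p.2 ∧ p.2 ≤ b + p.1 / T} :=
    (measurableSet_le (f := fun p : ℝ × ℝ => a + p.1 / T) (by fun_prop) measurable_snd).inter
      (measurableSet_le (g := fun p : ℝ × ℝ => b + p.1 / T) measurable_snd (by fun_prop))
  have hint : Integrable (Function.uncurry fun z x : ℝ =>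
      (Set.indicator {p : ℝ × ℝ | a + p.1 / T ≤ p.2 ∧ p.2 ≤ b + p.1 / T}
        (fun p => fejerKernel p.1)) (z, x)) (volume.prod ν) := by
    have : Integrable (fun p : ℝ × ℝ => fejerKernel p.1) (volume.prod ν) :=
      integrable_fejerKernel.comp_fst ν
    exact this.indicator hset
  have h1 := integral_integral_swap hint
  convert h1 using 1
  · congr 1
    funext z
    have : (fun x => (Set.indicator {p : ℝ × ℝ | a + p.1 / T ≤ p.2 ∧ p.2 ≤ b + p.1 / T}
        (fun p => fejerKernel p.1)) (z, x)) =
        (Set.Icc (a + z / T) (b + z / T)).indicator fun _ => fejerKernel z := by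
      funext x
      simp only [Set.indicator, Set.mem_Icc]
      rfl
    rw [this, integral_indicator_const _ measurableSet_Icc, smul_eq_mul, mul_comm]
  · congr 1
    funext x
    have : (fun z => (Set.indicator {p : ℝ × ℝ | a + p.1 / T ≤ p.2 ∧ p.2 ≤ b + p.1 / T}
        (fun p => fejerKernel p.1)) (z, x)) =
        (Set.Icc (T * (x - b)) (T * (x - a))).indicator fejerKernel := by
      funext z
      have h2 : (a + z / T ≤ x ∧ x ≤ b + z / T) ↔ (T * (x - b) ≤ z ∧ z ≤ T * (x - a)) := by
        rw [← le_sub_iff_add_le', div_le_iff₀' hT, ← sub_le_iff_le_add', le_div_iff₀' hT]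
        exact and_comm
      simp only [Set.indicator, Set.mem_Icc, Set.mem_ofPred_eq, h2]
    rw [this, integral_indicator measurableSet_Icc, integral_Icc_eq_integral_Ioc,
      intervalIntegral.integral_of_le (by gcongr)]

lemma integral_cos_interval {t : ℝ} (ht : t ≠ 0) (p q : ℝ) :
    ∫ z in p..q, Real.cos (t * z) = (Real.sin (t * q) - Real.sin (t * p)) / t := by
  rw [intervalIntegral.integral_comp_mul_left _ ht, integral_cos, smul_eq_mul, div_eq_inv_mul]

lemma continuous_integral_cos_interval (T a b : ℝ) :
    Continuous fun p : ℝ × ℝ => (1 - p.1) *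
      ∫ z in T * (p.2 - b)..T * (p.2 - a), Real.cos (p.1 * z) := by
  have h : ∀ c : ℝ, Continuous fun p : ℝ × ℝ => ∫ z in (0:ℝ)..T * (p.2 - c), Real.cos (p.1 * z) := by
    intro c
    refine intervalIntegral.continuous_parametric_intervalIntegral_of_continuous ?_ (by fun_prop)
    unfold Function.uncurry
    fun_prop
  have h2 : (fun p : ℝ × ℝ => (1 - p.1) *
      ∫ z in T * (p.2 - b)..T * (p.2 - a), Real.cos (p.1 * z)) = fun p : ℝ × ℝ => (1 - p.1) *
      ((∫ z in (0:ℝ)..T * (p.2 - a), Real.cos (p.1 * z)) -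
        ∫ z in (0:ℝ)..T * (p.2 - b), Real.cos (p.1 * z)) := by
    funext p
    rw [intervalIntegral.integral_interval_sub_left] <;>
    · apply Continuous.intervalIntegrable
      fun_prop
  rw [h2]
  have := h a
  have := h b
  fun_prop

/-- Keeping the cosine integral unevaluated avoids the quotient by `t`: the integrand stays bounded
by `|T * (b - a)|` down to `t = 0`, which justifies Fubini. -/
lemma integrable_triangle_mul_integral_cos (ν : Measure ℝ) [IsProbabilityMeasure ν] (T a b : ℝ) :
    Integrable (fun p : ℝ × ℝ => (1 - p.1) *
      ∫ z in T * (p.2 - b)..T * (p.2 - a), Real.cos (p.1 * z))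
      ((volume.restrict (Set.uIoc (0:ℝ) 1)).prod ν) := by
  have : IsFiniteMeasure (volume.restrict (Set.uIoc (0:ℝ) 1)) :=
    ⟨by simp [Set.uIoc_of_le]⟩
  refine Integrable.of_bound (continuous_integral_cos_interval T a b).aestronglyMeasurable
    (1 * (1 * |T * (b - a)|)) ?_
  have h : ∀ᵐ p ∂((volume.restrict (Set.uIoc (0:ℝ) 1)).prod ν), p.1 ∈ Set.uIoc (0:ℝ) 1 :=
    Measure.quasiMeasurePreserving_fst.ae (ae_restrict_mem measurableSet_uIoc)
  filter_upwards [h] with p hp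
  rw [Set.uIoc_of_le zero_le_one] at hp
  rw [norm_mul]
  gcongr
  · rw [Real.norm_eq_abs, abs_le]
    constructor <;> linarith [hp.1, hp.2]
  · refine (intervalIntegral.norm_integral_le_of_norm_le_const (C := 1) fun z _ => ?_).trans
      (le_of_eq ?_)
    · exact Real.abs_cos_le_one _
    · congr 2; ring

lemma integral_sin_sub_eq_charFun (ν : Measure ℝ) [IsProbabilityMeasure ν] (s a : ℝ) :
    ∫ x, Real.sin (s * (x - a)) ∂ν =
      (charFun ν s * Complex.exp (-(s * a : ℝ) * Complex.I)).im := by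
  rw [charFun_apply_real, ← integral_mul_const]
  have hi : Integrable (fun x : ℝ => Complex.exp (s * x * Complex.I) *
      Complex.exp (-(s * a : ℝ) * Complex.I)) ν := by
    refine Integrable.of_bound (by fun_prop) 1 (Filter.Eventually.of_forall fun x => ?_)
    rw [norm_mul]
    rw [show ((s:ℂ) * x * Complex.I) = ((s * x : ℝ) : ℂ) * Complex.I by push_cast; ring,
      ← Complex.ofReal_neg, Complex.norm_exp_ofReal_mul_I, Complex.norm_exp_ofReal_mul_I]
    norm_num
  have := integral_im hi
  simp only [RCLike.im_to_complex] at this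
  rw [← this]
  congr 1
  funext x
  rw [← Complex.exp_add, show ((s:ℂ) * x * Complex.I + -(s * a : ℝ) * Complex.I) =
    ((s * (x - a) : ℝ) : ℂ) * Complex.I by push_cast; ring, Complex.exp_ofReal_mul_I_im]

lemma integrable_sin_sub (ν : Measure ℝ) [IsProbabilityMeasure ν] (s a : ℝ) :
    Integrable (fun x => Real.sin (s * (x - a))) ν :=
  Integrable.of_bound (by fun_prop) 1
    (Filter.Eventually.of_forall fun x => by simpa using Real.abs_sin_le_one _)

/-- The scaling of the measure `ds / s` on the half-line. -/
lemma lintegral_div_comp_mul_left {c : ℝ} (hc : 0 < c) (f : ℝ → ENNReal) (hf : Measurable f) (a b : ℝ) :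
    ∫⁻ s in Set.Ioc a b, f (c * s) / ENNReal.ofReal s =
      ∫⁻ s in Set.Ioc (c * a) (c * b), f s / ENNReal.ofReal s := by
  rw [← lintegral_indicator measurableSet_Ioc, ← lintegral_indicator measurableSet_Ioc]
  conv_rhs => rw [← Real.smul_map_volume_mul_left hc.ne']
  have hm : Measurable ((Set.Ioc (c * a) (c * b)).indicator fun s => f s / ENNReal.ofReal s) :=
    (by fun_prop : Measurable fun s => f s / ENNReal.ofReal s).indicator measurableSet_Ioc
  rw [lintegral_smul_measure, lintegral_map hm (by fun_prop), smul_eq_mul,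
    ← lintegral_const_mul (ENNReal.ofReal |c|)
      (f := fun x => (Set.Ioc (c * a) (c * b)).indicator (fun s => f s / ENNReal.ofReal s) (c * x))
      (hm.comp (measurable_const_mul c))]
  congr 1
  funext s
  simp only [Set.indicator, Set.mem_Ioc, mul_lt_mul_iff_right₀ hc, mul_le_mul_iff_right₀ hc]
  split_ifs
  · rw [abs_of_pos hc, ENNReal.ofReal_mul hc.le, ENNReal.div_eq_inv_mul, ENNReal.div_eq_inv_mul,
      ENNReal.mul_inv (by simp [hc]) (by simp), ← mul_assoc, ← mul_assoc,
      ENNReal.mul_inv_cancel (by simp [hc]) (by simp), one_mul]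
  · simp

lemma integral_fejerKernel_mul_measureReal_eq (ν : Measure ℝ) [IsProbabilityMeasure ν] {T a b : ℝ}
    (hT : 0 < T) (hab : a ≤ b) :
    ∫ z, fejerKernel z * ν.real (Set.Icc (a + z / T) (b + z / T)) =
      ∫ t in Set.Ioc (0 : ℝ) 1, ∫ x, (1 - t) *
        (∫ z in T * (x - b)..T * (x - a), Real.cos (t * z)) ∂ν := by
  rw [integral_fejerKernel_mul_measureReal ν hT hab]
  simp_rw [integral_fejerKernel_interval]
  rw [← intervalIntegral.integral_of_le zero_le_one, intervalIntegral_integral_swap]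
  exact integrable_triangle_mul_integral_cos ν T a b

lemma integral_triangle_mul_integral_cos (ν : Measure ℝ) [IsProbabilityMeasure ν] (T a b : ℝ)
    {t : ℝ} (ht : 0 < t) :
    ∫ x, (1 - t) * (∫ z in T * (x - b)..T * (x - a), Real.cos (t * z)) ∂ν =
      (1 - t) / t * ((charFun ν (T * t) * (Complex.exp (-(T * t * a : ℝ) * Complex.I) -
        Complex.exp (-(T * t * b : ℝ) * Complex.I))).im) := by
  simp_rw [integral_cos_interval ht.ne', ← mul_assoc t T, mul_comm t T]
  rw [integral_const_mul, integral_div, integral_sub (integrable_sin_sub _ _ _)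
    (integrable_sin_sub _ _ _), integral_sin_sub_eq_charFun, integral_sin_sub_eq_charFun,
    mul_sub, Complex.sub_im]
  ring

lemma integrable_fejerKernel_mul_measureReal (ν : Measure ℝ) [IsProbabilityMeasure ν] (T a b : ℝ) :
    Integrable fun z => fejerKernel z * ν.real (Set.Icc (a + z / T) (b + z / T)) := by
  have hset : MeasurableSet {p : ℝ × ℝ | a + p.1 / T ≤ p.2 ∧ p.2 ≤ b + p.1 / T} :=
    (measurableSet_le (f := fun p : ℝ × ℝ => a + p.1 / T) (by fun_prop) measurable_snd).inter
      (measurableSet_le (g := fun p : ℝ × ℝ => b + p.1 / T) measurable_snd (by fun_prop))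
  have hm : Measurable fun z => ν.real (Set.Icc (a + z / T) (b + z / T)) :=
    (measurable_measure_prodMk_left (ν := ν) hset).ennreal_toReal
  refine integrable_fejerKernel.mul_bdd (c := 1) hm.aestronglyMeasurable
    (Filter.Eventually.of_forall fun z => ?_)
  rw [Real.norm_of_nonneg measureReal_nonneg]
  exact measureReal_le_one

/-- The kernel is the transform of a triangle on `[0, 1]`, so smoothing at scale `1 / T` sees only
frequencies `s = T * t ≤ T`. The endpoints enter through a difference of two unimodular factors,
hence the bound 2 uniform in the interval. -/
lemma abs_integral_fejerKernel_mul_sub_le (ν γ : Measure ℝ) [IsProbabilityMeasure ν]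
    [IsProbabilityMeasure γ] {T ε a b : ℝ} (hT : 0 < T) (hε : 0 ≤ ε) (hab : a ≤ b)
    (h : ∫⁻ s in Set.Ioc 0 T, ‖charFun ν s - charFun γ s‖ₑ / ENNReal.ofReal s ≤
      ENNReal.ofReal ε) :
    |∫ z, fejerKernel z * (ν.real (Set.Icc (a + z / T) (b + z / T)) -
      γ.real (Set.Icc (a + z / T) (b + z / T)))| ≤ 2 * ε := by
  simp_rw [mul_sub]
  rw [integral_sub (integrable_fejerKernel_mul_measureReal ν T a b)
    (integrable_fejerKernel_mul_measureReal γ T a b),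
    integral_fejerKernel_mul_measureReal_eq ν hT hab,
    integral_fejerKernel_mul_measureReal_eq γ hT hab]
  have hi : ∀ (ν : Measure ℝ) [IsProbabilityMeasure ν], IntegrableOn (fun t => ∫ x, (1 - t) *
        (∫ z in T * (x - b)..T * (x - a), Real.cos (t * z)) ∂ν) (Set.Ioc 0 1) := by
    intro ν _
    have := (integrable_triangle_mul_integral_cos ν T a b).integral_prod_left
    rwa [Set.uIoc_of_le zero_le_one] at this
  rw [← integral_sub (hi ν) (hi γ), ← Real.norm_eq_abs, ← ENNReal.ofReal_le_ofReal_iff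
    (by positivity), ofReal_norm]
  refine (enorm_integral_le_lintegral_enorm _).trans ?_
  have hb : ∀ t ∈ Set.Ioc (0 : ℝ) 1, ‖(∫ x, (1 - t) *
        (∫ z in T * (x - b)..T * (x - a), Real.cos (t * z)) ∂ν) - ∫ x, (1 - t) *
        (∫ z in T * (x - b)..T * (x - a), Real.cos (t * z)) ∂γ‖ₑ ≤
      2 * (‖charFun ν (T * t) - charFun γ (T * t)‖ₑ / ENNReal.ofReal t) := by
    intro t ht
    rw [integral_triangle_mul_integral_cos ν T a b ht.1,
      integral_triangle_mul_integral_cos γ T a b ht.1, ← mul_sub, ← Complex.sub_im, ← sub_mul]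
    set Δ := charFun ν (T * t) - charFun γ (T * t)
    have h1 : ‖Complex.exp (-(T * t * a : ℝ) * Complex.I) -
        Complex.exp (-(T * t * b : ℝ) * Complex.I)‖ ≤ 2 := by
      refine (norm_sub_le _ _).trans ?_
      rw [← Complex.ofReal_neg, ← Complex.ofReal_neg, Complex.norm_exp_ofReal_mul_I,
        Complex.norm_exp_ofReal_mul_I]
      norm_num
    have h2 : ‖(1 - t) / t * (Δ * (Complex.exp (-(T * t * a : ℝ) * Complex.I) -
        Complex.exp (-(T * t * b : ℝ) * Complex.I))).im‖ ≤ 2 * (‖Δ‖ / t) := by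
      rw [norm_mul, Real.norm_eq_abs, Real.norm_eq_abs, abs_div, abs_of_pos ht.1]
      calc _ ≤ 1 / t * (‖Δ‖ * 2) := by
            have ht0 := ht.1
            gcongr
            · rw [abs_le]; constructor <;> linarith [ht.2]
            · refine (Complex.abs_im_le_norm _).trans ?_
              rw [norm_mul]
              gcongr
        _ = _ := by ring
    rw [← ofReal_norm, ← ofReal_norm, ← ENNReal.ofReal_div_of_pos ht.1]
    refine (ENNReal.ofReal_le_ofReal h2).trans ?_
    rw [ENNReal.ofReal_mul (by norm_num)]
    simp
  refine (setLIntegral_mono' measurableSet_Ioc hb).trans ?_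
  have hm : Measurable fun s => ‖charFun ν s - charFun γ s‖ₑ :=
    (measurable_charFun.sub measurable_charFun).enorm
  rw [lintegral_const_mul _ (by fun_prop)]
  have := lintegral_div_comp_mul_left hT _ hm 0 1
  simp only [mul_zero, mul_one] at this
  rw [this, ENNReal.ofReal_mul (by norm_num)]
  gcongr
  simp

/-- An Esseen-type smoothing inequality for the probabilities of intervals. -/
lemma exists_smoothing_inequality : ∃ C : ℝ, 0 < C ∧ ∀ (ν γ : Measure ℝ) [IsProbabilityMeasure ν]
    [IsProbabilityMeasure γ], (∀ a b, a ≤ b → γ.real (Set.Icc a b) ≤ b - a) →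
    ∀ T ε : ℝ, 0 < T → 0 ≤ ε →
    ∫⁻ s in Set.Ioc 0 T, ‖charFun ν s - charFun γ s‖ₑ / ENNReal.ofReal s ≤ ENNReal.ofReal ε →
    ∀ a b, a < b → |ν.real (Set.Icc a b) - γ.real (Set.Icc a b)| ≤ C * (ε + 1 / T) := by
  obtain ⟨h, h0, htail⟩ := exists_fejerKernel_tail
  set I := ∫ y, fejerKernel y with hI
  have hI0 : 0 < I := integral_fejerKernel_pos
  set J := ∫ y in Set.Icc (-h) h, fejerKernel y with hJ
  have hJI : J + ∫ y in (Set.Icc (-h) h)ᶜ, fejerKernel y = I :=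
    integral_add_compl measurableSet_Icc integrable_fejerKernel
  -- Solving `S ≤ 2 * (h / T) + 8 / (3 * I) * ε + S / 3` for the supremum `S` produces the factor `3
  -- / 2`.
  refine ⟨3 / 2 * (2 * h + 8 / (3 * I)), by positivity, ?_⟩
  intro ν γ _ _ hγ T ε hT hε hint a b hab
  set D : ℝ → ℝ → ℝ := fun a b => ν.real (Set.Icc a b) - γ.real (Set.Icc a b) with hD
  have hγ3 : ∀ a c d b, a ≤ c → d ≤ b → γ.real (Set.Icc a b) ≤
      γ.real (Set.Icc c d) + (c - a) + (b - d) := by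
    intro a c d b hac hdb
    have hsub : Set.Icc a b ⊆ Set.Icc c d ∪ Set.Icc a c ∪ Set.Icc d b := by
      intro x hx
      by_cases h1 : x ≤ c
      · exact Or.inl (Or.inr ⟨hx.1, h1⟩)
      by_cases h2 : d ≤ x
      · exact Or.inr ⟨h2, hx.2⟩
      · exact Or.inl (Or.inl ⟨(not_le.1 h1).le, (not_le.1 h2).le⟩)
    refine (measureReal_mono hsub).trans ((measureReal_union_le _ _).trans ?_)
    gcongr
    · refine (measureReal_union_le _ _).trans ?_
      gcongr
      exact hγ _ _ hac
    · exact hγ _ _ hdb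
  have hD1 : ∀ a b, |D a b| ≤ 1 := fun a b => by
    rw [abs_le]
    constructor <;> simp only [hD] <;>
    linarith [measureReal_nonneg (μ := ν) (s := Set.Icc a b), measureReal_le_one (μ := ν) (s := Set.Icc a b),
      measureReal_nonneg (μ := γ) (s := Set.Icc a b), measureReal_le_one (μ := γ) (s := Set.Icc a b)]
  set S : ℝ := ⨆ p : {p : ℝ × ℝ // p.1 < p.2}, |D p.1.1 p.1.2| with hS
  have hbdd : BddAbove (Set.range fun p : {p : ℝ × ℝ // p.1 < p.2} => |D p.1.1 p.1.2|) :=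
    ⟨1, by rintro _ ⟨p, rfl⟩; exact hD1 _ _⟩
  have hDS : ∀ a b, a < b → |D a b| ≤ S := fun a b hab => le_ciSup hbdd ⟨(a, b), hab⟩
  have hS0 : 0 ≤ S := (abs_nonneg _).trans (hDS a b hab)
  -- If `σ * D` is at least `c` on the window, its smoothed value is at least `c * (3 / 4 * I) - S *
  -- (I / 4)`, while it is at most `2 * ε`. The sign `σ` treats both directions at once.
  have hkey : ∀ (σ c : ℝ) (a b : ℝ), |σ| ≤ 1 → a < b →
      (∀ z ∈ Set.Icc (-h) h, c ≤ σ * D (a + z / T) (b + z / T)) → c ≤ 8 / (3 * I) * ε + S / 3 := by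
    intro σ c a b hσ hab hc
    by_cases hc0 : c < 0
    · have : 0 ≤ 8 / (3 * I) * ε + S / 3 := by positivity
      linarith
    have hbound := abs_integral_fejerKernel_mul_sub_le ν γ hT hε hab.le hint
    have hint' : Integrable fun z => fejerKernel z * (σ * D (a + z / T) (b + z / T)) := by
      have := ((integrable_fejerKernel_mul_measureReal ν T a b).sub
        (integrable_fejerKernel_mul_measureReal γ T a b)).const_mul σ
      refine this.congr (Filter.Eventually.of_forall fun z => ?_)
      simp only [hD, Pi.sub_apply]
      ring
    have h1 : ∫ z, fejerKernel z * (σ * D (a + z / T) (b + z / T)) ≤ 2 * ε := by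
      have : ∫ z, fejerKernel z * (σ * D (a + z / T) (b + z / T)) =
          σ * ∫ z, fejerKernel z * D (a + z / T) (b + z / T) := by
        rw [← integral_const_mul]
        congr 1; funext z; ring
      rw [this]
      refine (le_abs_self _).trans ?_
      rw [abs_mul]
      calc _ ≤ 1 * (2 * ε) := by gcongr
        _ = _ := one_mul _
    have h2 : c * J ≤ ∫ z in Set.Icc (-h) h, fejerKernel z * (σ * D (a + z / T) (b + z / T)) := by
      rw [hJ, ← integral_const_mul]
      refine setIntegral_mono_on (integrable_fejerKernel.const_mul c).integrableOn
        hint'.integrableOn measurableSet_Icc fun z hz => ?_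
      rw [mul_comm]
      exact mul_le_mul_of_nonneg_left (hc z hz) (fejerKernel_nonneg z)
    have h3 : -S * (I - J) ≤ ∫ z in (Set.Icc (-h) h)ᶜ, fejerKernel z *
        (σ * D (a + z / T) (b + z / T)) := by
      rw [← hJI, add_sub_cancel_left, ← integral_const_mul]
      refine setIntegral_mono_on (integrable_fejerKernel.const_mul _).integrableOn
        hint'.integrableOn measurableSet_Icc.compl fun z _ => ?_
      rw [mul_comm]
      refine mul_le_mul_of_nonneg_left ?_ (fejerKernel_nonneg z)
      have h4 : |σ * D (a + z / T) (b + z / T)| ≤ 1 * S := by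
        rw [abs_mul]
        exact mul_le_mul hσ (hDS _ _ (by linarith)) (abs_nonneg _) zero_le_one
      rw [one_mul] at h4
      exact (abs_le.1 h4).1
    rw [← integral_add_compl measurableSet_Icc hint'] at h1
    have h5 : c * (3 / 4 * I) ≤ c * J := mul_le_mul_of_nonneg_left htail (not_lt.1 hc0)
    have h6 : S * (I - J) ≤ S * (I / 4) := mul_le_mul_of_nonneg_left (by linarith) hS0
    have h7 : c * (3 / 4 * I) ≤ 2 * ε + S * (I / 4) := by linarith
    have h8 : 8 / (3 * I) * ε + S / 3 = (2 * ε + S * (I / 4)) / (3 / 4 * I) := by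
      field_simp
      ring
    rw [h8, le_div_iff₀ (by positivity)]
    exact h7
  have hzT : ∀ z ∈ Set.Icc (-h) h, -(h / T) ≤ z / T ∧ z / T ≤ h / T := fun z hz =>
    ⟨by rw [← neg_div]; exact div_le_div_of_nonneg_right hz.1 hT.le,
      div_le_div_of_nonneg_right hz.2 hT.le⟩
  have hhT : 0 < h / T := by positivity
  have hstep : ∀ a b, a < b → |D a b| ≤ 2 * (h / T) + 8 / (3 * I) * ε + S / 3 := by
    intro a b hab
    rw [abs_le]
    constructor
    -- For the lower bound the interval is shrunk by `h / T` at each end, so that its translates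
    -- stay inside. When it is too short for this, the mass under `γ` is itself at most `2 * (h /
    -- T)`.
    · by_cases hlen : b - a ≤ 2 * (h / T)
      · have : 0 ≤ 8 / (3 * I) * ε + S / 3 := by positivity
        have h1 := hγ a b hab.le
        have h2 := measureReal_nonneg (μ := ν) (s := Set.Icc a b)
        simp only [hD]
        linarith
      · have := hkey (-1) (-D a b - 2 * (h / T)) (a + h / T) (b - h / T) (by norm_num)
          (by linarith) fun z hz => by
            obtain ⟨hz1, hz2⟩ := hzT z hz
            have h1 : ν.real (Set.Icc (a + h / T + z / T) (b - h / T + z / T)) ≤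
                ν.real (Set.Icc a b) :=
              measureReal_mono (Set.Icc_subset_Icc (by linarith) (by linarith))
            have h2 := hγ3 a (a + h / T + z / T) (b - h / T + z / T) b (by linarith) (by linarith)
            simp only [hD]
            linarith
        linarith
    · have := hkey 1 (D a b - 2 * (h / T)) (a - h / T) (b + h / T) (by norm_num)
          (by linarith) fun z hz => by
            obtain ⟨hz1, hz2⟩ := hzT z hz
            have h1 : ν.real (Set.Icc a b) ≤
                ν.real (Set.Icc (a - h / T + z / T) (b + h / T + z / T)) :=
              measureReal_mono (Set.Icc_subset_Icc (by linarith) (by linarith))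
            have h2 := hγ3 (a - h / T + z / T) a b (b + h / T + z / T) (by linarith) (by linarith)
            simp only [hD]
            linarith
      linarith
  have hSle : S ≤ 2 * (h / T) + 8 / (3 * I) * ε + S / 3 := by
    have : Nonempty {p : ℝ × ℝ // p.1 < p.2} := ⟨⟨(a, b), hab⟩⟩
    exact ciSup_le fun p => hstep _ _ p.2
  have hfin := hDS a b hab
  have e1 : 3 / 2 * (2 * h + 8 / (3 * I)) * (ε + 1 / T) = 3 / 2 * (2 * (h / T) + 8 / (3 * I) * ε)
      + 3 / 2 * (2 * h * ε + 8 / (3 * I) * (1 / T)) := by ring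
  have e2 : 0 ≤ 3 / 2 * (2 * h * ε + 8 / (3 * I) * (1 / T)) := by positivity
  rw [e1]
  linarith

/-! ### Characteristic functions of standardized laws -/

/-- A measure on the line with mean zero, variance one and a finite fourth moment. -/
structure IsStandardized (ν : Measure ℝ) : Prop where
  integrable_pow_four : Integrable (fun x => x ^ 4) ν
  mean_zero : ∫ x, x ∂ν = 0
  variance_one : ∫ x, x ^ 2 ∂ν = 1

namespace IsStandardized

variable {ν : Measure ℝ} [IsProbabilityMeasure ν]

lemma integrable_pow (h : IsStandardized ν) {k : ℕ} (hk : k ≤ 4) :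
    Integrable (fun x => x ^ k) ν := by
  refine (h.integrable_pow_four.add (integrable_const 1)).mono' (by fun_prop)
    (Filter.Eventually.of_forall fun x => ?_)
  simp only [Pi.add_apply, norm_pow, Real.norm_eq_abs]
  rw [← Even.pow_abs (by decide : Even 4) x]
  rcases le_total |x| 1 with h1 | h1
  · have : |x| ^ k ≤ 1 := pow_le_one₀ (abs_nonneg x) h1
    have : 0 ≤ |x| ^ 4 := by positivity
    linarith
  · have : |x| ^ k ≤ |x| ^ 4 := pow_le_pow_right₀ h1 hk
    linarith

/-- Nonnegativity of `∫ (x² - s x)²` with `s` the third moment; the mixed term and the variance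
combine to `-s²`. -/
lemma sq_third_moment_le (h : IsStandardized ν) :
    (∫ x, x ^ 3 ∂ν) ^ 2 ≤ ∫ x, x ^ 4 ∂ν := by
  set s := ∫ x, x ^ 3 ∂ν with hs
  have h1 : 0 ≤ ∫ x, (x ^ 2 - s * x) ^ 2 ∂ν := integral_nonneg fun x => sq_nonneg _
  have h2 : ∫ x, (x ^ 2 - s * x) ^ 2 ∂ν = (∫ x, x ^ 4 ∂ν) - 2 * s * s + s ^ 2 * 1 := by
    have : ∀ x : ℝ, (x ^ 2 - s * x) ^ 2 = x ^ 4 - 2 * s * x ^ 3 + s ^ 2 * x ^ 2 := fun x => by ring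
    simp_rw [this]
    rw [integral_add, integral_sub, integral_const_mul, integral_const_mul, h.variance_one]
    · exact h.integrable_pow_four
    · exact (h.integrable_pow (by norm_num)).const_mul _
    · exact h.integrable_pow_four.sub ((h.integrable_pow (by norm_num)).const_mul _)
    · exact (h.integrable_pow (by norm_num)).const_mul _
  nlinarith

lemma one_le_fourth_moment (h : IsStandardized ν) : 1 ≤ ∫ x, x ^ 4 ∂ν := by
  have h1 : 0 ≤ ∫ x, (x ^ 2 - 1) ^ 2 ∂ν := integral_nonneg fun x => sq_nonneg _
  have h2 : ∫ x, (x ^ 2 - 1) ^ 2 ∂ν = (∫ x, x ^ 4 ∂ν) - 2 * 1 + 1 := by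
    have : ∀ x : ℝ, (x ^ 2 - 1) ^ 2 = x ^ 4 - 2 * x ^ 2 + 1 := fun x => by ring
    simp_rw [this]
    rw [integral_add, integral_sub, integral_const_mul, h.variance_one]
    · simp
    · exact h.integrable_pow_four
    · exact (h.integrable_pow (by norm_num)).const_mul _
    · exact h.integrable_pow_four.sub ((h.integrable_pow (by norm_num)).const_mul _)
    · exact integrable_const _
  linarith

end IsStandardized

lemma norm_cexp_mul_I_sub_taylor_le (y : ℝ) :
    ‖Complex.exp (y * Complex.I) - (1 + y * Complex.I - y ^ 2 / 2 - y ^ 3 / 6 * Complex.I)‖ ≤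
      4 * y ^ 4 := by
  have hn : ‖(y : ℂ) * Complex.I‖ = |y| := by simp
  have h4 : |y| ^ 4 = y ^ 4 := Even.pow_abs (by decide) y
  have hI3 : Complex.I ^ 3 = -Complex.I := by rw [pow_succ, Complex.I_sq]; ring
  rcases le_total |y| 1 with h | h
  · have := Complex.exp_bound (x := y * Complex.I) (by rwa [hn]) (n := 4) (by norm_num)
    rw [hn, h4] at this
    have e : ∑ m ∈ Finset.range 4, ((y : ℂ) * Complex.I) ^ m / (m.factorial : ℂ) =
        1 + y * Complex.I - y ^ 2 / 2 - y ^ 3 / 6 * Complex.I := by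
      simp [Finset.sum_range_succ, Nat.factorial, mul_pow, hI3]
      ring
    rw [e] at this
    refine this.trans ?_
    have : 0 ≤ y ^ 4 := by positivity
    norm_num [Nat.factorial]
    linarith
  · have h2 : |y| ≤ |y| ^ 4 := le_self_pow₀ h (by norm_num)
    have h3 : |y| ^ 2 ≤ |y| ^ 4 := pow_le_pow_right₀ h (by norm_num)
    have h3' : |y| ^ 3 ≤ |y| ^ 4 := pow_le_pow_right₀ h (by norm_num)
    have h5 : 1 ≤ |y| ^ 4 := one_le_pow₀ h
    have h6 : ‖(1 + y * Complex.I - y ^ 2 / 2 - y ^ 3 / 6 * Complex.I : ℂ)‖ ≤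
        1 + |y| + |y| ^ 2 / 2 + |y| ^ 3 / 6 := by
      refine (norm_sub_le _ _).trans ?_
      gcongr
      · refine (norm_sub_le _ _).trans ?_
        gcongr
        · refine (norm_add_le _ _).trans ?_
          simp
        · simp
      · simp
    refine (norm_sub_le _ _).trans ?_
    rw [Complex.norm_exp_ofReal_mul_I, ← h4]
    linarith

namespace IsStandardized

variable {ν : Measure ℝ} [IsProbabilityMeasure ν]

lemma norm_charFun_sub_taylor_le (h : IsStandardized ν) (t : ℝ) :
    ‖charFun ν t - (1 - t ^ 2 / 2 - ((∫ x, x ^ 3 ∂ν : ℝ) * t ^ 3 / 6) * Complex.I)‖ ≤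
      4 * (∫ x, x ^ 4 ∂ν) * t ^ 4 := by
  have i1 : Integrable (fun x : ℝ => ((x : ℝ) : ℂ)) ν := by
    simpa using (h.integrable_pow (k := 1) (by norm_num)).ofReal (𝕜 := ℂ)
  have i2 : Integrable (fun x : ℝ => ((x ^ 2 : ℝ) : ℂ)) ν :=
    (h.integrable_pow (k := 2) (by norm_num)).ofReal
  have i3 : Integrable (fun x : ℝ => ((x ^ 3 : ℝ) : ℂ)) ν :=
    (h.integrable_pow (k := 3) (by norm_num)).ofReal
  have iE : Integrable (fun x : ℝ => Complex.exp (t * x * Complex.I)) ν := by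
    refine Integrable.of_bound (by fun_prop) 1 (Filter.Eventually.of_forall fun x => ?_)
    rw [show ((t:ℂ) * x * Complex.I) = ((t * x : ℝ) : ℂ) * Complex.I by push_cast; ring,
      Complex.norm_exp_ofReal_mul_I]
  have iP : Integrable (fun x : ℝ => (1 + (t * Complex.I) * ((x : ℝ) : ℂ) -
      (t ^ 2 / 2) * ((x ^ 2 : ℝ) : ℂ) - (t ^ 3 / 6 * Complex.I) * ((x ^ 3 : ℝ) : ℂ) : ℂ)) ν :=
    (((integrable_const 1).add (i1.const_mul _)).sub (i2.const_mul _)).sub (i3.const_mul _)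
  have e : (1 - t ^ 2 / 2 - ((∫ x, x ^ 3 ∂ν : ℝ) * t ^ 3 / 6) * Complex.I : ℂ) =
      ∫ x : ℝ, (1 + (t * Complex.I) * ((x : ℝ) : ℂ) -
      (t ^ 2 / 2) * ((x ^ 2 : ℝ) : ℂ) - (t ^ 3 / 6 * Complex.I) * ((x ^ 3 : ℝ) : ℂ) : ℂ) ∂ν := by
    rw [integral_sub, integral_sub, integral_add, integral_const_mul, integral_const_mul,
      integral_const_mul, integral_complex_ofReal, integral_complex_ofReal,
      integral_complex_ofReal, h.mean_zero, h.variance_one]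
    · simp
      ring
    · exact integrable_const 1
    · exact i1.const_mul _
    · exact (integrable_const 1).add (i1.const_mul _)
    · exact i2.const_mul _
    · exact ((integrable_const 1).add (i1.const_mul _)).sub (i2.const_mul _)
    · exact i3.const_mul _
  rw [e, charFun_apply_real, ← integral_sub iE iP]
  have hb : Integrable (fun x => 4 * t ^ 4 * x ^ 4) ν := h.integrable_pow_four.const_mul _
  refine (norm_integral_le_of_norm_le hb (Filter.Eventually.of_forall fun x => ?_)).trans
    (le_of_eq ?_)
  · have := norm_cexp_mul_I_sub_taylor_le (t * x)
    convert this using 1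
    · congr 1
      push_cast
      ring
    · ring
  · rw [integral_const_mul]
    ring

/-- The threshold `1 / 100` keeps the Taylor polynomial below `1 - 2 / 5 * t ^ 2` and the remainder
below `t ^ 2 / 25`. -/
lemma norm_charFun_le_one_sub (h : IsStandardized ν) {t : ℝ}
    (ht : t ^ 2 * ∫ x, x ^ 4 ∂ν ≤ 1 / 100) : ‖charFun ν t‖ ≤ 1 - t ^ 2 / 4 := by
  have hm := h.one_le_fourth_moment
  have hγ := h.sq_third_moment_le
  have h1 := h.norm_charFun_sub_taylor_le t
  set m := ∫ x, x ^ 4 ∂ν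
  set γ := ∫ x, x ^ 3 ∂ν
  have ht2 : t ^ 2 ≤ 1 / 100 := by nlinarith [sq_nonneg t]
  have h2 : ‖(1 - t ^ 2 / 2 - (γ * t ^ 3 / 6) * Complex.I : ℂ)‖ ≤ 1 - 2 / 5 * t ^ 2 := by
    rw [show (1 - t ^ 2 / 2 - (γ * t ^ 3 / 6) * Complex.I : ℂ) =
      ((1 - t ^ 2 / 2 : ℝ) : ℂ) + ((-(γ * t ^ 3 / 6) : ℝ) : ℂ) * Complex.I by push_cast; ring,
      Complex.norm_add_mul_I]
    rw [Real.sqrt_le_left (by nlinarith)]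
    have h3 : γ ^ 2 * t ^ 6 ≤ t ^ 4 / 100 := by
      have : γ ^ 2 * t ^ 6 ≤ m * t ^ 6 := by gcongr
      have h5 : (t ^ 2 * m) * t ^ 4 ≤ 1 / 100 * t ^ 4 := by gcongr
      nlinarith
    have h4 : t ^ 4 ≤ t ^ 2 / 100 := by nlinarith [sq_nonneg t]
    nlinarith [sq_nonneg t]
  have h3 : 4 * m * t ^ 4 ≤ t ^ 2 / 25 := by
    have : (t ^ 2 * m) * t ^ 2 ≤ 1 / 100 * t ^ 2 := by gcongr
    nlinarith
  have h4 := norm_le_norm_add_norm_sub' (charFun ν t) (1 - t ^ 2 / 2 - (γ * t ^ 3 / 6) * Complex.I)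
  nlinarith [sq_nonneg t]

end IsStandardized

/-! ### Gaussian averages of characteristic functions -/

lemma integral_charFun_comp_mul_gaussian (ρ : Measure ℝ) [IsProbabilityMeasure ρ] (s : ℝ) :
    ∫ g, charFun ρ (s * g) ∂(gaussianReal 0 1) =
      ((∫ y, Real.exp (-(s * y) ^ 2 / 2) ∂ρ : ℝ) : ℂ) := by
  simp_rw [charFun_apply_real]
  rw [integral_integral_swap, ← integral_complex_ofReal]
  · congr 1
    funext y
    have := charFun_gaussianReal (μ := 0) (v := 1) (s * y)
    rw [charFun_apply_real] at this
    rw [show (fun x : ℝ => Complex.exp (((s * x : ℝ) : ℂ) * y * Complex.I)) =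
      fun x : ℝ => Complex.exp (((s * y : ℝ) : ℂ) * x * Complex.I) by
        funext x; congr 1; push_cast; ring, this]
    push_cast
    congr 1
    simp
    ring
  · refine Integrable.of_bound (by unfold Function.uncurry; fun_prop) 1
      (Filter.Eventually.of_forall fun p => ?_)
    simp only [Function.uncurry]
    rw [show (((s * p.1 : ℝ) : ℂ) * p.2 * Complex.I) = ((s * p.1 * p.2 : ℝ) : ℂ) * Complex.I by
      push_cast; ring, Complex.norm_exp_ofReal_mul_I]

/-- `|φ|²` is the characteristic function of the symmetrization `X - X'`; its law is `ρ`. -/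
lemma integral_norm_sq_charFun_gaussian (ν : Measure ℝ) [IsProbabilityMeasure ν] :
    ∃ ρ : Measure ℝ, IsProbabilityMeasure ρ ∧ ∀ s : ℝ,
      ∫ g, ‖charFun ν (s * g)‖ ^ 2 ∂(gaussianReal 0 1) =
        ∫ y, Real.exp (-(s * y) ^ 2 / 2) ∂ρ := by
  have : IsProbabilityMeasure (ν.map fun x => -1 * x) :=
    Measure.isProbabilityMeasure_map (by fun_prop)
  refine ⟨ν ∗ (ν.map fun x => -1 * x), inferInstance, fun s => ?_⟩
  have h := integral_charFun_comp_mul_gaussian (ν ∗ (ν.map fun x => -1 * x)) s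
  have h2 : ∀ g : ℝ, charFun (ν ∗ (ν.map fun x => -1 * x)) (s * g) =
      ((‖charFun ν (s * g)‖ ^ 2 : ℝ) : ℂ) := fun g => by
    rw [charFun_conv, charFun_map_mul, neg_one_mul, charFun_neg, Complex.mul_conj,
      Complex.normSq_eq_norm_sq]
  simp_rw [h2] at h
  rw [integral_complex_ofReal] at h
  exact_mod_cast h

/-- The characteristic function itself may return to modulus one, as for lattice laws; its Gaussian
average is a mixture of functions `exp(-(s y)²/2)` and cannot increase with `|s|`. -/
lemma integral_norm_sq_charFun_gaussian_anti (ν : Measure ℝ) [IsProbabilityMeasure ν] {s s' : ℝ}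
    (hs : s ^ 2 ≤ s' ^ 2) : ∫ g, ‖charFun ν (s' * g)‖ ^ 2 ∂(gaussianReal 0 1) ≤
      ∫ g, ‖charFun ν (s * g)‖ ^ 2 ∂(gaussianReal 0 1) := by
  obtain ⟨ρ, _, h⟩ := integral_norm_sq_charFun_gaussian ν
  rw [h, h]
  have hi : ∀ s : ℝ, Integrable (fun y => Real.exp (-(s * y) ^ 2 / 2)) ρ := fun s => by
    refine Integrable.of_bound (by fun_prop) 1 (Filter.Eventually.of_forall fun y => ?_)
    rw [Real.norm_of_nonneg (Real.exp_pos _).le, Real.exp_le_one_iff]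
    nlinarith [sq_nonneg (s * y)]
  refine integral_mono (hi _) (hi _) fun y => ?_
  simp only [Real.exp_le_exp, mul_pow]
  nlinarith [mul_le_mul_of_nonneg_right hs (sq_nonneg y)]

/-- At `s₀` the pointwise bound applies for `|g| ≤ 1` and gains `s₀² g² / 4`; monotonicity carries
the gain to every larger `s`. -/
lemma exists_integral_norm_charFun_gaussian_le : ∃ c : ℝ, 0 < c ∧
    ∀ (ν : Measure ℝ) [IsProbabilityMeasure ν], IsStandardized ν → ∀ s₀ s : ℝ,
      s₀ ^ 2 * ∫ x, x ^ 4 ∂ν ≤ 1 / 100 → s₀ ^ 2 ≤ s ^ 2 →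
      ∫ g, ‖charFun ν (s * g)‖ ∂(gaussianReal 0 1) ≤ 1 - c * s₀ ^ 2 := by
  set c₀ := ∫ g in Set.Icc (-1 : ℝ) 1, g ^ 2 ∂(gaussianReal 0 1) with hc₀
  have hint : IntegrableOn (fun g : ℝ => g ^ 2) (Set.Icc (-1 : ℝ) 1) (gaussianReal 0 1) :=
    (by fun_prop : Continuous fun g : ℝ => g ^ 2).continuousOn.integrableOn_compact isCompact_Icc
  have hpos : 0 < c₀ := by
    rw [hc₀, setIntegral_pos_iff_support_of_nonneg_ae
      (Filter.Eventually.of_forall fun g => sq_nonneg g) hint]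
    have h1 : 0 < volume (Set.Ioo (0 : ℝ) 1) := by simp
    have h2 : 0 < gaussianReal 0 1 (Set.Ioo (0 : ℝ) 1) := by
      rw [pos_iff_ne_zero] at h1 ⊢
      exact fun h => h1 (gaussianReal_absolutelyContinuous' 0 one_ne_zero h)
    refine h2.trans_le (measure_mono fun x hx => ⟨?_, ?_⟩)
    · simpa using hx.1.ne'
    · exact ⟨by linarith [hx.1], hx.2.le⟩
  refine ⟨c₀ / 8, by positivity, fun ν _ h s₀ s hs0 hss => ?_⟩
  have hm := h.one_le_fourth_moment
  set m := ∫ x, x ^ 4 ∂ν with hmdef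
  have hi : ∀ s : ℝ, Integrable (fun g => ‖charFun ν (s * g)‖) (gaussianReal 0 1) := fun s =>
    Integrable.of_bound ((measurable_charFun.comp
      (measurable_const_mul s)).norm.aestronglyMeasurable) 1
      (Filter.Eventually.of_forall fun g => by simpa using norm_charFun_le_one _)
  have hi2 : ∀ s : ℝ, Integrable (fun g => ‖charFun ν (s * g)‖ ^ 2) (gaussianReal 0 1) := fun s =>
    Integrable.of_bound (((measurable_charFun.comp
      (measurable_const_mul s)).norm.pow_const 2).aestronglyMeasurable) 1
      (Filter.Eventually.of_forall fun g => by
        simpa using norm_charFun_le_one _)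
  have h1 : ∫ g, ‖charFun ν (s₀ * g)‖ ^ 2 ∂(gaussianReal 0 1) ≤ 1 - s₀ ^ 2 / 4 * c₀ := by
    have : 1 - s₀ ^ 2 / 4 * c₀ = ∫ g, (1 - s₀ ^ 2 / 4 * (Set.Icc (-1 : ℝ) 1).indicator
        (fun g => g ^ 2) g) ∂(gaussianReal 0 1) := by
      rw [integral_sub (integrable_const 1)
        ((hint.integrable_indicator measurableSet_Icc).const_mul _), integral_const_mul,
        integral_indicator measurableSet_Icc]
      simp [hc₀]
    rw [this]
    refine integral_mono (hi2 s₀) ((integrable_const 1).sub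
        ((hint.integrable_indicator measurableSet_Icc).const_mul _)) fun g => ?_
    have hle := norm_charFun_le_one (μ := ν) (s₀ * g)
    have hsq : ‖charFun ν (s₀ * g)‖ ^ 2 ≤ ‖charFun ν (s₀ * g)‖ :=
      pow_le_of_le_one (norm_nonneg _) hle two_ne_zero
    by_cases hg : g ∈ Set.Icc (-1 : ℝ) 1
    · simp only [Set.indicator_of_mem hg]
      refine hsq.trans ((h.norm_charFun_le_one_sub ?_).trans (le_of_eq (by ring)))
      have : g ^ 2 ≤ 1 := by nlinarith [hg.1, hg.2]
      rw [mul_pow, ← hmdef]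
      calc _ ≤ s₀ ^ 2 * 1 * m := by gcongr
        _ ≤ _ := by linarith
    · simp only [Set.indicator_of_notMem hg]
      linarith
  have h2 := integral_norm_sq_charFun_gaussian_anti ν hss
  -- Squares give way to first powers by `x ≤ (1 + x²) / 2`, which halves the gain: hence `c₀ / 8`.
  have h3 : ∫ g, ‖charFun ν (s * g)‖ ∂(gaussianReal 0 1) ≤
      ∫ g, (1 / 2 + ‖charFun ν (s * g)‖ ^ 2 / 2) ∂(gaussianReal 0 1) :=
    integral_mono (hi s) ((integrable_const _).add ((hi2 s).div_const 2)) fun g => by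
      nlinarith [sq_nonneg (‖charFun ν (s * g)‖ - 1)]
  rw [integral_add (integrable_const _) ((hi2 s).div_const 2),
    integral_div (2 : ℝ) fun g => ‖charFun ν (s * g)‖ ^ 2] at h3
  simp only [integral_const, probReal_univ, one_smul] at h3
  linarith

lemma abs_one_sub_mul_exp_sub_one_le {q : ℝ} (h0 : 0 ≤ q) (h1 : q ≤ 1) :
    |(1 - q) * Real.exp q - 1| ≤ q ^ 2 := by
  have h2 := Real.add_one_le_exp q
  have h3 := (abs_le.1 (Real.abs_exp_sub_one_sub_id_le (x := q) (by rwa [abs_of_nonneg h0]))).2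
  rw [abs_le]
  constructor
  · nlinarith
  · nlinarith [pow_nonneg h0 3]

/-- The factor `exp(t²/2)` cancels the quadratic term, so the logarithm starts with the cubic one. A
logarithm makes these cubic terms add over the factors of a product, where they may cancel. -/
lemma IsStandardized.exists_log_charFun {ν : Measure ℝ} [IsProbabilityMeasure ν]
    (h : IsStandardized ν) {t : ℝ} (ht : t ^ 4 * ∫ x, x ^ 4 ∂ν ≤ 1 / 10000) :
    ∃ l : ℂ, Complex.exp l = charFun ν t * Real.exp (t ^ 2 / 2) ∧
      ‖l + ((t ^ 3 * ∫ x, x ^ 3 ∂ν : ℝ) : ℂ) / 6 * Complex.I‖ ≤ 10 * (t ^ 4 * ∫ x, x ^ 4 ∂ν) := by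
  have hm := h.one_le_fourth_moment
  have hγ := h.sq_third_moment_le
  have h1 := h.norm_charFun_sub_taylor_le t
  set m := ∫ x, x ^ 4 ∂ν
  set γ := ∫ x, x ^ 3 ∂ν
  set q := t ^ 2 / 2 with hq
  have ht4 : t ^ 4 ≤ t ^ 4 * m := le_mul_of_one_le_right (by positivity) hm
  have ht2 : t ^ 2 ≤ 1 / 100 := by
    refine abs_le_of_sq_le_sq' ?_ (by norm_num) |>.2
    nlinarith
  have hq0 : 0 ≤ q := by positivity
  have hq1 : q ≤ 1 / 200 := by rw [hq]; linarith
  have hm0 : 0 ≤ t ^ 4 * m := by positivity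
  set w : ℂ := charFun ν t * Real.exp q - 1 with hw
  have hγm : |γ| ≤ m := abs_le_of_sq_le_sq (by nlinarith) (by linarith)
  have ht1 : |t| ≤ 1 / 10 := abs_le_of_sq_le_sq (by nlinarith) (by norm_num)
  have hexp1 : Real.exp q ≤ 1 + 2 * q := by
    have := (abs_le.1 (Real.abs_exp_sub_one_sub_id_le (x := q)
      (by rw [abs_of_nonneg hq0]; linarith))).2
    nlinarith
  have hexp2 : 1 ≤ Real.exp q := Real.one_le_exp hq0
  have hr : ‖w + ((t ^ 3 * γ : ℝ) : ℂ) / 6 * Complex.I‖ ≤ 9 * (t ^ 4 * m) := by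
    have e : w + ((t ^ 3 * γ : ℝ) : ℂ) / 6 * Complex.I =
        (((1 - q) * Real.exp q - 1 : ℝ) : ℂ) +
        ((-(t ^ 3 * γ / 6) * (Real.exp q - 1) : ℝ) : ℂ) * Complex.I +
        (charFun ν t - (1 - t ^ 2 / 2 - (γ * t ^ 3 / 6) * Complex.I)) * (Real.exp q : ℝ) := by
      rw [hw, hq]
      push_cast
      ring
    have b1 : |(1 - q) * Real.exp q - 1| ≤ 1 / 4 * (t ^ 4 * m) := by
      refine (abs_one_sub_mul_exp_sub_one_le hq0 (by linarith)).trans ?_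
      rw [hq]
      nlinarith
    have b2 : |-(t ^ 3 * γ / 6) * (Real.exp q - 1)| ≤ 1 / 6 * (t ^ 4 * m) := by
      rw [abs_mul, abs_neg, abs_div, abs_mul, abs_pow, abs_of_nonneg (by linarith : 0 ≤ Real.exp q - 1),
        abs_of_pos (by norm_num : (0:ℝ) < 6)]
      have : Real.exp q - 1 ≤ |t| ^ 2 := by rw [sq_abs]; linarith
      calc |t| ^ 3 * |γ| / 6 * (Real.exp q - 1) ≤ |t| ^ 3 * m / 6 * |t| ^ 2 := by gcongr
        _ = |t| * (1 / 6 * (|t| ^ 4 * m)) := by ring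
        _ ≤ 1 * (1 / 6 * (|t| ^ 4 * m)) := by gcongr; linarith
        _ = _ := by rw [Even.pow_abs (by decide : Even 4)]; ring
    have b3 : ‖(charFun ν t - (1 - t ^ 2 / 2 - (γ * t ^ 3 / 6) * Complex.I)) *
        (Real.exp q : ℝ)‖ ≤ 8 * (t ^ 4 * m) := by
      rw [norm_mul, Complex.norm_real, Real.norm_of_nonneg (by linarith)]
      calc _ ≤ (4 * m * t ^ 4) * 2 := by gcongr; linarith
        _ = _ := by ring
    rw [e]
    refine (norm_add_le _ _).trans ?_
    refine (add_le_add_left (norm_add_le _ _) _).trans ?_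
    rw [norm_mul _ Complex.I, Complex.norm_I, mul_one, Complex.norm_real, Complex.norm_real,
      Real.norm_eq_abs, Real.norm_eq_abs]
    linarith
  -- By `γ² ≤ m`, the square of the cubic term is of fourth order, so the quadratic error of the
  -- logarithm fits in the remainder.
  have hg6 : (t ^ 3 * γ) ^ 2 ≤ 1 / 100 * (t ^ 4 * m) := by
    calc (t ^ 3 * γ) ^ 2 = t ^ 4 * (γ ^ 2 * t ^ 2) := by ring
      _ ≤ t ^ 4 * (m * (1 / 100)) := by gcongr
      _ = _ := by ring
  have hwn : ‖w‖ ≤ |t ^ 3 * γ| / 6 + 9 * (t ^ 4 * m) := by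
    have := norm_sub_le (w + ((t ^ 3 * γ : ℝ) : ℂ) / 6 * Complex.I)
      (((t ^ 3 * γ : ℝ) : ℂ) / 6 * Complex.I)
    rw [add_sub_cancel_right] at this
    refine this.trans ?_
    have h6 : ‖((t ^ 3 * γ : ℝ) : ℂ) / 6 * Complex.I‖ = |t ^ 3 * γ| / 6 := by
      rw [norm_mul _ Complex.I, Complex.norm_I, mul_one, norm_div, Complex.norm_real,
        Real.norm_eq_abs]
      norm_num
    rw [h6]
    linarith
  have habs : |t ^ 3 * γ| ≤ 1 / 1000 := abs_le_of_sq_le_sq (by nlinarith) (by norm_num)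
  have hw2 : ‖w‖ ≤ 1 / 2 := by linarith
  have hwsq : ‖w‖ ^ 2 ≤ t ^ 4 * m := by
    have hsq : |t ^ 3 * γ| ^ 2 ≤ 1 / 100 * (t ^ 4 * m) := by rwa [sq_abs]
    have : ‖w‖ ^ 2 ≤ (|t ^ 3 * γ| / 6 + 9 * (t ^ 4 * m)) ^ 2 := by gcongr
    nlinarith [abs_nonneg (t ^ 3 * γ), sq_nonneg (|t ^ 3 * γ| / 6 - 9 * (t ^ 4 * m))]
  have hne : 1 + w ≠ 0 := by
    intro h0
    have : w = -1 := by linear_combination h0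
    rw [this] at hw2
    norm_num at hw2
  refine ⟨Complex.log (1 + w), by rw [Complex.exp_log hne, hw]; ring, ?_⟩
  have hlog := Complex.norm_log_one_add_sub_self_le (z := w) (by linarith)
  have hinv : (1 - ‖w‖)⁻¹ ≤ 2 := by
    rw [inv_le_comm₀ (by linarith) (by norm_num)]
    linarith
  have hlog2 : ‖Complex.log (1 + w) - w‖ ≤ t ^ 4 * m := by
    refine hlog.trans ?_
    have : 0 ≤ (1 - ‖w‖)⁻¹ := inv_nonneg.2 (by linarith)
    calc ‖w‖ ^ 2 * (1 - ‖w‖)⁻¹ / 2 ≤ (t ^ 4 * m) * 2 / 2 := by gcongr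
      _ = _ := by ring
  have := norm_add_le (Complex.log (1 + w) - w) (w + ((t ^ 3 * γ : ℝ) : ℂ) / 6 * Complex.I)
  rw [← add_assoc, sub_add_cancel] at this
  linarith

/-- Edgeworth-type comparison of a product of characteristic functions with the Gaussian one. -/
lemma norm_prod_charFun_sub_exp_le {ι : Type*} [Fintype ι] (ν : ι → Measure ℝ)
    [∀ j, IsProbabilityMeasure (ν j)] (h : ∀ j, IsStandardized (ν j)) (t : ι → ℝ) {a b : ℝ}
    (ha : ∑ j, t j ^ 4 * ∫ x, x ^ 4 ∂(ν j) ≤ a) (ha' : a ≤ 1 / 10000)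
    (hb : |∑ j, t j ^ 3 * ∫ x, x ^ 3 ∂(ν j)| ≤ b) (hb' : b ≤ 1) :
    ‖∏ j, charFun (ν j) (t j) - Real.exp (-(∑ j, t j ^ 2) / 2)‖ ≤
      (20 * a + b) * Real.exp (-(∑ j, t j ^ 2) / 2) := by
  have hnn : ∀ j, 0 ≤ t j ^ 4 * ∫ x, x ^ 4 ∂(ν j) := fun j => by
    have := (h j).one_le_fourth_moment
    positivity
  choose l hl1 hl2 using fun j => (h j).exists_log_charFun (t := t j)
    (((Finset.single_le_sum (fun j _ => hnn j) (Finset.mem_univ j)).trans ha).trans ha')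
  have hE : (Real.exp (-(∑ j, t j ^ 2) / 2) : ℂ) * ∏ j, (Real.exp (t j ^ 2 / 2) : ℂ) = 1 := by
    rw [← Complex.ofReal_prod, ← Real.exp_sum, ← Complex.ofReal_mul, ← Real.exp_add,
      ← Finset.sum_div, neg_div, neg_add_cancel, Real.exp_zero, Complex.ofReal_one]
  have hprod : ∏ j, charFun (ν j) (t j) =
      Real.exp (-(∑ j, t j ^ 2) / 2) * Complex.exp (∑ j, l j) := by
    rw [Complex.exp_sum, Finset.prod_congr rfl fun j _ => hl1 j, Finset.prod_mul_distrib,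
      mul_left_comm, hE, mul_one]
  have hW : ‖∑ j, l j‖ ≤ b / 6 + 10 * a := by
    have e : ∑ j, l j = ∑ j, (l j + ((t j ^ 3 * ∫ x, x ^ 3 ∂(ν j) : ℝ) : ℂ) / 6 * Complex.I) -
        ((∑ j, t j ^ 3 * ∫ x, x ^ 3 ∂(ν j) : ℝ) : ℂ) / 6 * Complex.I := by
      rw [Finset.sum_add_distrib, Complex.ofReal_sum, Finset.sum_div, Finset.sum_mul]
      ring
    rw [e]
    refine (norm_sub_le _ _).trans ?_
    rw [add_comm]
    gcongr
    · rw [norm_mul _ Complex.I, Complex.norm_I, mul_one, norm_div, Complex.norm_real,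
        Real.norm_eq_abs]
      norm_num
      linarith
    · refine (norm_sum_le _ _).trans ((Finset.sum_le_sum fun j _ => hl2 j).trans ?_)
      rw [← Finset.mul_sum]
      linarith
  have hb0 := (abs_nonneg _).trans hb
  -- The exponent has norm at most `1 / 6 + 10 / 10000 < 1`, so `|exp w - 1| ≤ 2 |w|`.
  have hexp := Complex.norm_exp_sub_one_le (x := ∑ j, l j) (by linarith)
  rw [hprod, show (Real.exp (-(∑ j, t j ^ 2) / 2) : ℂ) * Complex.exp (∑ j, l j) -
    Real.exp (-(∑ j, t j ^ 2) / 2) = Real.exp (-(∑ j, t j ^ 2) / 2) *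
      (Complex.exp (∑ j, l j) - 1) by ring, norm_mul, Complex.norm_real,
    Real.norm_of_nonneg (Real.exp_pos _).le, mul_comm]
  gcongr
  linarith

/-! ### Tail bounds for Gaussian vectors -/

lemma integrable_exp_sq_div_four_gaussian :
    Integrable (fun x : ℝ => Real.exp (x ^ 2 / 4)) (gaussianReal 0 1) := by
  rw [gaussianReal_of_var_ne_zero 0 one_ne_zero, integrable_withDensity_iff_integrable_smul'
    (measurable_gaussianPDF 0 1) (Filter.Eventually.of_forall fun x => gaussianPDF_lt_top)]
  refine ((integrable_exp_neg_mul_sq (b := 1 / 4) (by norm_num)).const_mul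
    (√(2 * Real.pi))⁻¹).congr (Filter.Eventually.of_forall fun x => ?_)
  simp only [toReal_gaussianPDF, gaussianPDFReal, smul_eq_mul, NNReal.coe_one, mul_one, sub_zero]
  rw [mul_assoc, ← Real.exp_add]
  ring_nf

lemma integral_exp_sq_div_four_gaussian_le :
    ∫ x : ℝ, Real.exp (x ^ 2 / 4) ∂(gaussianReal 0 1) ≤ 2 := by
  rw [integral_gaussianReal_eq_integral_smul one_ne_zero]
  have : ∀ x : ℝ, gaussianPDFReal 0 1 x • Real.exp (x ^ 2 / 4) =
      (√(2 * Real.pi))⁻¹ * Real.exp (-(1 / 4) * x ^ 2) := fun x => by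
    simp only [gaussianPDFReal, smul_eq_mul, NNReal.coe_one, mul_one, sub_zero]
    rw [mul_assoc, ← Real.exp_add]
    ring_nf
  simp_rw [this]
  rw [integral_const_mul, integral_gaussian, inv_mul_le_iff₀ (by positivity)]
  refine (Real.sqrt_le_sqrt (y := 2 ^ 2 * (2 * Real.pi)) (by nlinarith [Real.pi_pos])).trans ?_
  rw [Real.sqrt_mul (by norm_num), Real.sqrt_sq (by norm_num), mul_comm]

lemma sq_pow_le_mul_exp (x : ℝ) (q : ℕ) :
    (x ^ 2) ^ q ≤ (4 * q) ^ q * Real.exp (x ^ 2 / 4) := by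
  have h := Real.pow_div_factorial_le_exp (x ^ 2 / 4) (by positivity) q
  rw [div_le_iff₀ (by positivity)] at h
  have h2 : (q.factorial : ℝ) ≤ (q : ℝ) ^ q := by exact_mod_cast Nat.factorial_le_pow q
  calc (x ^ 2) ^ q = 4 ^ q * (x ^ 2 / 4) ^ q := by rw [← mul_pow]; ring
    _ ≤ 4 ^ q * (Real.exp (x ^ 2 / 4) * (q : ℝ) ^ q) := by gcongr; exact h.trans (by gcongr)
    _ = _ := by rw [mul_pow]; ring

lemma integrable_sq_pow_gaussian (q : ℕ) :
    Integrable (fun x : ℝ => (x ^ 2) ^ q) (gaussianReal 0 1) :=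
  (integrable_exp_sq_div_four_gaussian.const_mul ((4 * q : ℝ) ^ q)).mono' (by fun_prop)
    (Filter.Eventually.of_forall fun x => by
      rw [Real.norm_of_nonneg (by positivity)]
      exact sq_pow_le_mul_exp x q)

lemma integral_sq_pow_gaussian_le (q : ℕ) :
    ∫ x : ℝ, (x ^ 2) ^ q ∂(gaussianReal 0 1) ≤ (4 * q) ^ q * 2 := by
  refine (integral_mono (integrable_sq_pow_gaussian q)
    (integrable_exp_sq_div_four_gaussian.const_mul _) (sq_pow_le_mul_exp · q)).trans ?_
  rw [integral_const_mul]
  gcongr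
  exact integral_exp_sq_div_four_gaussian_le

/-- Tails of nonnegative combinations of even powers of independent Gaussians. -/
lemma stdGaussianPi_sum_pow_tail {n : ℕ} (w : Fin n → ℝ) (hw : ∀ j, 0 ≤ w j) {p k : ℕ}
    (hp : 1 ≤ p) (hk : 1 ≤ k) :
    (stdGaussianPi n).real {g | Real.exp 1 * (4 * (p * k)) ^ p * ∑ j, w j <
      ∑ j, w j * (g j ^ 2) ^ p} ≤ 2 * Real.exp (-k) := by
  set W := ∑ j, w j with hW
  -- The weights are normalized below, so zero total weight is separate; it occurs when all third
  -- moments vanish.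
  rcases (Finset.sum_nonneg fun j _ => hw j : 0 ≤ W).eq_or_lt with h0 | hpos
  · have : {g : Fin n → ℝ | Real.exp 1 * (4 * (p * k)) ^ p * W <
      ∑ j, w j * (g j ^ 2) ^ p} = ∅ := by
      ext g
      have hz : ∀ j, w j = 0 := fun j =>
        (Finset.sum_eq_zero_iff_of_nonneg fun j _ => hw j).1 h0.symm j (Finset.mem_univ j)
      simp [hz, hW]
    rw [this]
    simp only [measureReal_empty]
    positivity
  set q := p * k with hq
  have hM : (0 : ℝ) < (4 * q : ℝ) ^ q := by
    have : 0 < q := Nat.mul_pos hp hk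
    positivity
  -- By convexity `f` dominates the `k`-th power of the normalized sum. Markov's inequality for `f`
  -- at `exp k` times its moment scale gives `2 * exp (-k)`.
  set f : (Fin n → ℝ) → ℝ := fun g => ∑ j, w j / W * (g j ^ 2) ^ q with hf
  have hfi : ∀ j, Integrable (fun g : Fin n → ℝ => w j / W * (g j ^ 2) ^ q) (stdGaussianPi n) :=
    fun j => (integrable_comp_eval (μ := fun _ : Fin n => gaussianReal 0 1) (i := j)
      (integrable_sq_pow_gaussian q)).const_mul _
  have hfint : Integrable f (stdGaussianPi n) := integrable_finsetSum _ fun j _ => hfi j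
  have hf0 : ∀ g, 0 ≤ f g := fun g => Finset.sum_nonneg fun j _ => by
    have := hw j
    positivity
  have hsum1 : ∑ j, w j / W = 1 := by rw [← Finset.sum_div, div_self hpos.ne']
  have hfle : ∫ g, f g ∂(stdGaussianPi n) ≤ (4 * q) ^ q * 2 := by
    rw [hf, integral_finsetSum _ fun j _ => hfi j]
    calc _ ≤ ∑ j, w j / W * ((4 * q : ℝ) ^ q * 2) := by
          refine Finset.sum_le_sum fun j _ => ?_
          rw [integral_const_mul, integral_comp_eval (μ := fun _ : Fin n => gaussianReal 0 1)
            (i := j) (f := fun x => (x ^ 2) ^ q) (by fun_prop)]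
          have := hw j
          gcongr
          exact integral_sq_pow_gaussian_le q
      _ = _ := by rw [← Finset.sum_mul, hsum1, one_mul]
  have hsub : {g : Fin n → ℝ | Real.exp 1 * (4 * (p * k)) ^ p * W <
      ∑ j, w j * (g j ^ 2) ^ p} ⊆ {g | Real.exp k * (4 * q) ^ q ≤ f g} := by
    intro g hg
    simp only [Set.mem_ofPred_eq] at hg ⊢
    have h1 : Real.exp 1 * (4 * (p * k)) ^ p ≤ ∑ j, w j / W * (g j ^ 2) ^ p := by
      have : ∑ j, w j / W * (g j ^ 2) ^ p = (∑ j, w j * (g j ^ 2) ^ p) / W := by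
        rw [Finset.sum_div]
        exact Finset.sum_congr rfl fun j _ => by ring
      rw [this, le_div_iff₀ hpos]
      exact hg.le
    have h2 := Real.pow_arith_mean_le_arith_mean_pow Finset.univ (fun j => w j / W)
      (fun j => (g j ^ 2) ^ p) (fun j _ => div_nonneg (hw j) hpos.le) hsum1
      (fun j _ => by positivity) k
    calc Real.exp k * (4 * q) ^ q = (Real.exp 1 * (4 * (p * k)) ^ p) ^ k := by
          rw [mul_pow (Real.exp 1), ← Real.exp_nat_mul, mul_one, ← pow_mul, hq]
          push_cast
          ring
      _ ≤ (∑ j, w j / W * (g j ^ 2) ^ p) ^ k := by gcongr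
      _ ≤ _ := h2.trans (le_of_eq (Finset.sum_congr rfl fun j _ => by rw [← pow_mul, hq]))
  have hmark := mul_meas_ge_le_integral_of_nonneg (Filter.Eventually.of_forall hf0) hfint
    (Real.exp k * (4 * q) ^ q)
  have h3 := measureReal_mono hsub (μ := stdGaussianPi n)
  have h4 : Real.exp k * (4 * q) ^ q * (stdGaussianPi n).real {g | Real.exp k * (4 * q) ^ q ≤ f g} ≤
      (4 * q) ^ q * 2 := hmark.trans hfle
  refine h3.trans ?_
  rw [Real.exp_neg, ← div_eq_mul_inv, le_div_iff₀ (Real.exp_pos _)]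
  refine le_of_mul_le_mul_left ?_ hM
  linarith

/-- Chernoff's bound for a sum of functions of independent Gaussians. -/
lemma stdGaussianPi_chernoff {n : ℕ} (h : Fin n → ℝ → ℝ) (q : Fin n → ℝ)
    (hint : ∀ j, Integrable (fun x => Real.exp (h j x)) (gaussianReal 0 1))
    (hq : ∀ j, ∫ x, Real.exp (h j x) ∂(gaussianReal 0 1) ≤ q j) (c : ℝ) :
    (stdGaussianPi n).real {g | c ≤ ∑ j, h j (g j)} ≤ Real.exp (-c) * ∏ j, q j := by
  have hI : Integrable (fun g : Fin n → ℝ => ∏ j, Real.exp (h j (g j))) (stdGaussianPi n) :=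
    Integrable.fintype_prod (μ := fun _ => gaussianReal 0 1) hint
  have hE : ∫ g, ∏ j, Real.exp (h j (g j)) ∂(stdGaussianPi n) ≤ ∏ j, q j := by
    rw [integral_fintype_prod_eq_prod (fun j x => Real.exp (h j x))]
    exact Finset.prod_le_prod (fun j _ => integral_nonneg fun x => (Real.exp_pos _).le)
      fun j _ => hq j
  have hm := mul_meas_ge_le_integral_of_nonneg (Filter.Eventually.of_forall fun g =>
    Finset.prod_nonneg fun j _ => (Real.exp_pos (h j (g j))).le) hI (Real.exp c)
  have hset : {g : Fin n → ℝ | Real.exp c ≤ ∏ j, Real.exp (h j (g j))} =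
      {g | c ≤ ∑ j, h j (g j)} := by
    ext g
    simp only [Set.mem_ofPred_eq, ← Real.exp_sum, Real.exp_le_exp]
  rw [hset] at hm
  rw [Real.exp_neg, inv_mul_eq_div, le_div_iff₀' (Real.exp_pos _)]
  exact hm.trans hE

lemma integrable_exp_sub_half_sq_gaussian {f : ℝ → ℝ} (hf : Measurable f) :
    Integrable (fun x => Real.exp (f x - f x ^ 2 / 2)) (gaussianReal 0 1) := by
  refine Integrable.of_bound (by fun_prop) (Real.exp 1) (Filter.Eventually.of_forall fun x => ?_)
  rw [Real.norm_of_nonneg (Real.exp_pos _).le, Real.exp_le_exp]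
  nlinarith [sq_nonneg (f x - 1)]

/-- By oddness and symmetry of the Gaussian, the exponential may be replaced by `cosh (f x)`, and
`cosh y ≤ exp(y²/2)`. The subtracted square makes this work without any exponential moment of `f`.
-/
lemma integral_exp_sub_half_sq_gaussian_le {f : ℝ → ℝ} (hf : Measurable f)
    (hodd : ∀ x, f (-x) = -f x) :
    ∫ x, Real.exp (f x - f x ^ 2 / 2) ∂(gaussianReal 0 1) ≤ 1 := by
  have hi := integrable_exp_sub_half_sq_gaussian hf
  have hi' := integrable_exp_sub_half_sq_gaussian hf.neg
  have hsymm : ∫ x, Real.exp ((-f) x - (-f) x ^ 2 / 2) ∂(gaussianReal 0 1) =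
      ∫ x, Real.exp (f x - f x ^ 2 / 2) ∂(gaussianReal 0 1) := by
    have hmap := gaussianReal_map_neg (μ := 0) (v := 1)
    rw [neg_zero] at hmap
    conv_rhs => rw [← hmap]
    rw [integral_map (by fun_prop) (by fun_prop)]
    simp [hodd]
  have hadd := integral_add hi hi'
  rw [hsymm] at hadd
  have hle : ∫ x, (Real.exp (f x - f x ^ 2 / 2) + Real.exp ((-f) x - (-f) x ^ 2 / 2))
      ∂(gaussianReal 0 1) ≤ ∫ _x, (2 : ℝ) ∂(gaussianReal 0 1) := by
    refine integral_mono (hi.add hi') (integrable_const 2) fun x => ?_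
    have h1 := Real.cosh_le_exp_half_sq (f x)
    rw [Real.cosh_eq] at h1
    have e : ∀ y : ℝ, Real.exp (y - f x ^ 2 / 2) = Real.exp y * (Real.exp (f x ^ 2 / 2))⁻¹ :=
      fun y => by rw [sub_eq_add_neg, Real.exp_add, Real.exp_neg]
    simp only [Pi.neg_apply, neg_sq]
    rw [e, e, ← add_mul, ← div_eq_mul_inv, div_le_iff₀ (Real.exp_pos _)]
    linarith
  simp only [integral_const, probReal_univ, one_smul] at hle
  linarith

/-- A self-normalized tail bound for sums of odd functions of independent Gaussians. -/
lemma stdGaussianPi_odd_tail {n : ℕ} (f : Fin n → ℝ → ℝ) (hf : ∀ j, Measurable (f j))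
    (hodd : ∀ j x, f j (-x) = -f j x) (c : ℝ) :
    (stdGaussianPi n).real {g | c ≤ ∑ j, (f j (g j) - f j (g j) ^ 2 / 2)} ≤ Real.exp (-c) := by
  have := stdGaussianPi_chernoff (fun j x => f j x - f j x ^ 2 / 2) (fun _ => 1)
    (fun j => integrable_exp_sub_half_sq_gaussian (hf j))
    (fun j => integral_exp_sub_half_sq_gaussian_le (hf j) (hodd j)) c
  simpa using this

lemma stdGaussianPi_norm_sq_tail (n : ℕ) :
    (stdGaussianPi n).real {g | 8 * n ≤ ∑ j, g j ^ 2} ≤ Real.exp (-n) := by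
  have h := stdGaussianPi_chernoff (n := n) (fun _ x => x ^ 2 / 4) (fun _ => 2)
    (fun _ => integrable_exp_sq_div_four_gaussian)
    (fun _ => integral_exp_sq_div_four_gaussian_le) (2 * n)
  have hset : {g : Fin n → ℝ | (2 * n : ℝ) ≤ ∑ j, g j ^ 2 / 4} =
      {g | (8 * n : ℝ) ≤ ∑ j, g j ^ 2} := by
    ext g
    simp only [Set.mem_ofPred_eq, ← Finset.sum_div]
    constructor <;> intro h <;> linarith
  rw [hset] at h
  refine h.trans ?_
  have h2 : (2 : ℝ) ^ n ≤ Real.exp n := by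
    rw [← mul_one (n : ℝ), Real.exp_nat_mul]
    gcongr
    linarith [Real.add_one_le_exp 1]
  simp only [Finset.prod_const, Finset.card_univ, Fintype.card_fin]
  calc Real.exp (-(2 * n)) * 2 ^ n ≤ Real.exp (-(2 * n)) * Real.exp n := by gcongr
    _ = _ := by rw [← Real.exp_add]; ring_nf

lemma exists_stdGaussianPi_count_tail : ∃ ε : ℝ, 0 < ε ∧ ε ≤ 1 ∧ ∀ (n : ℕ) (J : Finset (Fin n)),
    (stdGaussianPi n).real {g | ∑ j ∈ J, (Set.Icc (1 : ℝ) 4).indicator 1 (g j ^ 2) ≤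
      ε * (J.card : ℝ)} ≤ Real.exp (-(ε * J.card)) := by
  set φ : ℝ → ℝ := fun x => (Set.Icc (1 : ℝ) 4).indicator 1 (x ^ 2) with hφ
  have hφm : Measurable φ :=
    (measurable_const.indicator measurableSet_Icc).comp (by fun_prop)
  have hφ0 : ∀ x, 0 ≤ φ x := fun x => Set.indicator_nonneg (fun _ _ => zero_le_one) _
  have hi : Integrable (fun x => Real.exp (-φ x)) (gaussianReal 0 1) := by
    refine Integrable.of_bound (by fun_prop) 1 (Filter.Eventually.of_forall fun x => ?_)
    rw [Real.norm_of_nonneg (Real.exp_pos _).le, Real.exp_le_one_iff]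
    linarith [hφ0 x]
  set q := ∫ x, Real.exp (-φ x) ∂(gaussianReal 0 1) with hq
  have hq0 : 0 < q := integral_exp_pos hi
  have hq1 : q < 1 := by
    have h1 : 0 < ∫ x, (1 - Real.exp (-φ x)) ∂(gaussianReal 0 1) := by
      rw [integral_pos_iff_support_of_nonneg (f := fun x => 1 - Real.exp (-φ x)) _
        ((integrable_const 1).sub hi)]
      · have h1 : 0 < volume (Set.Ioo (1 : ℝ) 2) := by simp
        have h2 : 0 < gaussianReal 0 1 (Set.Ioo (1 : ℝ) 2) := by
          rw [pos_iff_ne_zero] at h1 ⊢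
          exact fun h => h1 (gaussianReal_absolutelyContinuous' 0 one_ne_zero h)
        refine h2.trans_le (measure_mono fun x hx => ?_)
        have hx' : x ^ 2 ∈ Set.Icc (1 : ℝ) 4 := ⟨by nlinarith [hx.1], by nlinarith [hx.1, hx.2]⟩
        have : φ x = 1 := by simp only [hφ, Set.indicator_of_mem hx', Pi.one_apply]
        simp only [Function.mem_support, this]
        have := Real.exp_lt_exp.2 (by norm_num : (-1 : ℝ) < 0)
        rw [Real.exp_zero] at this
        linarith
      · intro x
        have : Real.exp (-φ x) ≤ 1 := Real.exp_le_one_iff.2 (by linarith [hφ0 x])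
        simpa using this
    rw [integral_sub (integrable_const 1) hi] at h1
    simp only [integral_const, probReal_univ, one_smul] at h1
    linarith
  have hlog : Real.log q < 0 := Real.log_neg hq0 hq1
  -- This choice gives `q ≤ exp(-2ε)`: one factor `exp(-ε)` pays for the threshold, the other is the
  -- decay.
  refine ⟨min 1 (-Real.log q / 2), lt_min one_pos (by linarith), min_le_left _ _, fun n J => ?_⟩
  set ε := min 1 (-Real.log q / 2) with hε
  have hqε : q ≤ Real.exp (-(2 * ε)) := by
    rw [← Real.log_le_iff_le_exp hq0]
    have := min_le_right 1 (-Real.log q / 2)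
    linarith
  have h := stdGaussianPi_chernoff (n := n) (fun j x => if j ∈ J then -φ x else 0)
    (fun j => if j ∈ J then q else 1) (fun j => by split_ifs <;> simp [hi])
    (fun j => by split_ifs <;> simp [hq]) (-(ε * J.card))
  have hset : {g : Fin n → ℝ | -(ε * J.card) ≤ ∑ j, if j ∈ J then -φ (g j) else 0} =
      {g | ∑ j ∈ J, φ (g j) ≤ ε * J.card} := by
    ext g
    simp only [Set.mem_ofPred_eq, Finset.sum_ite_mem, Finset.univ_inter, Finset.sum_neg_distrib,
      neg_le_neg_iff]
  rw [hset, neg_neg, Finset.prod_ite_mem, Finset.univ_inter, Finset.prod_const] at h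
  refine h.trans ?_
  calc Real.exp (ε * J.card) * q ^ J.card
      ≤ Real.exp (ε * J.card) * Real.exp (-(2 * ε)) ^ J.card := by gcongr
    _ = _ := by
      rw [← Real.exp_nat_mul, ← Real.exp_add]
      ring_nf

/-! ### High frequencies in Gaussian directions -/

lemma measurable_norm_prod_charFun {ι : Type*} [Fintype ι] (ν : ι → Measure ℝ)
    [∀ j, IsProbabilityMeasure (ν j)] :
    Measurable fun p : ℝ × (ι → ℝ) => ‖∏ j, charFun (ν j) (p.1 * p.2 j)‖ₑ := by
  refine Measurable.enorm (Finset.measurable_fun_prod _ fun j _ => ?_)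
  exact measurable_charFun.comp (by fun_prop)

/-- Markov's inequality for an integral against `ds / s`. -/
lemma measureReal_lintegral_div_tail {α : Type*} [MeasurableSpace α] (P : Measure α) [SFinite P]
    {f : ℝ × α → ENNReal} (hf : Measurable f) {s₀ b η E : ℝ} (hs₀ : 0 < s₀) (hb : s₀ ≤ b)
    (hη : 0 < η) (hE : 0 ≤ E) (h : ∀ s, s₀ ≤ s → ∫⁻ g, f (s, g) ∂P ≤ ENNReal.ofReal E) :
    P.real {g | ENNReal.ofReal η < ∫⁻ s in Set.Ioc s₀ b, f (s, g) / ENNReal.ofReal s} ≤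
      E * (b / s₀) / η := by
  have hm : Measurable fun p : α × ℝ => f (p.2, p.1) / ENNReal.ofReal p.2 :=
    (hf.comp measurable_swap).div (by fun_prop)
  have hZ : ∫⁻ g, (∫⁻ s in Set.Ioc s₀ b, f (s, g) / ENNReal.ofReal s) ∂P ≤
      ENNReal.ofReal (E * (b / s₀)) := by
    rw [lintegral_lintegral_swap hm.aemeasurable]
    calc _ ≤ ∫⁻ s in Set.Ioc s₀ b, ENNReal.ofReal (E / s₀) := by
          refine setLIntegral_mono' measurableSet_Ioc fun s hs => ?_
          simp only [div_eq_mul_inv (_ : ENNReal)]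
          rw [lintegral_mul_const _ (f := fun g => f (s, g))
              (hf.comp (measurable_prodMk_left (x := s))),
            ← div_eq_mul_inv, ENNReal.ofReal_div_of_pos hs₀]
          exact ENNReal.div_le_div (h s hs.1.le) (ENNReal.ofReal_le_ofReal hs.1.le)
      _ ≤ _ := by
        rw [setLIntegral_const, Real.volume_Ioc, ← ENNReal.ofReal_mul (by positivity)]
        refine ENNReal.ofReal_le_ofReal ?_
        rw [div_mul_eq_mul_div, mul_div_assoc]
        gcongr
        linarith
  have hmark := meas_ge_le_lintegral_div (μ := P)
    (f := fun g => ∫⁻ s in Set.Ioc s₀ b, f (s, g) / ENNReal.ofReal s)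
    (Measurable.lintegral_prod_right' hm).aemeasurable (ε := ENNReal.ofReal η)
    (by simpa using hη) ENNReal.ofReal_ne_top
  have hb0 : 0 < b := hs₀.trans_le hb
  refine ENNReal.toReal_le_of_le_ofReal (by positivity) ?_
  refine le_trans (measure_mono ?_) (hmark.trans ?_)
  · intro g hg
    exact le_of_lt (show ENNReal.ofReal η < _ from hg)
  rw [ENNReal.ofReal_div_of_pos hη]
  gcongr

/-- Independence of the coordinates factorizes the mean; each index in `J` gains `exp(-c s₀²)` and
the others are bounded by one. -/
lemma exists_lintegral_prod_charFun_le : ∃ c : ℝ, 0 < c ∧ ∀ (n : ℕ) (ν : Fin n → Measure ℝ)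
    [∀ j, IsProbabilityMeasure (ν j)], (∀ j, IsStandardized (ν j)) →
    ∀ (J : Finset (Fin n)) (s₀ s : ℝ), 0 < s₀ → s₀ ≤ s →
    (∀ j ∈ J, s₀ ^ 2 * ∫ x, x ^ 4 ∂(ν j) ≤ 1 / 100) →
    ∫⁻ g, ‖∏ j, charFun (ν j) (s * g j)‖ₑ ∂(stdGaussianPi n) ≤
      ENNReal.ofReal (Real.exp (-(c * s₀ ^ 2 * J.card))) := by
  obtain ⟨c, hc, hmain⟩ := exists_integral_norm_charFun_gaussian_le
  refine ⟨c, hc, fun n ν _ hν J s₀ s hs₀ hs hJ => ?_⟩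
  have hm : ∀ j, Measurable fun x : ℝ => charFun (ν j) (s * x) := fun j =>
    measurable_charFun.comp (measurable_const_mul s)
  have hi : Integrable (fun g : Fin n → ℝ => ∏ j, charFun (ν j) (s * g j))
      (stdGaussianPi n) := Integrable.fintype_prod (μ := fun _ => gaussianReal 0 1)
    (f := fun j x => charFun (ν j) (s * x)) fun j =>
    Integrable.of_bound (hm j).aestronglyMeasurable 1
      (Filter.Eventually.of_forall fun x => norm_charFun_le_one _)
  rw [← ofReal_integral_norm_eq_lintegral_enorm hi]
  refine ENNReal.ofReal_le_ofReal ?_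
  simp_rw [norm_prod]
  rw [integral_fintype_prod_eq_prod (fun j x => ‖charFun (ν j) (s * x)‖)]
  calc ∏ j, ∫ x, ‖charFun (ν j) (s * x)‖ ∂(gaussianReal 0 1)
      ≤ ∏ j, if j ∈ J then Real.exp (-(c * s₀ ^ 2)) else 1 := by
        refine Finset.prod_le_prod (fun j _ => integral_nonneg fun x => norm_nonneg _)
          fun j _ => ?_
        split_ifs with hj
        · refine (hmain (ν j) (hν j) s₀ s (hJ j hj) (by gcongr)).trans ?_
          have := Real.add_one_le_exp (-(c * s₀ ^ 2))
          linarith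
        · refine (integral_mono_of_nonneg (Filter.Eventually.of_forall fun x => norm_nonneg _)
            (integrable_const 1) (Filter.Eventually.of_forall fun x =>
              norm_charFun_le_one _)).trans (by simp)
    _ = _ := by
      rw [Finset.prod_ite_mem, Finset.univ_inter, Finset.prod_const, ← Real.exp_nat_mul]
      ring_nf

/-- In Gaussian directions, the high frequencies of the characteristic function are small. -/
lemma exists_prod_charFun_tail : ∃ c : ℝ, 0 < c ∧ ∀ (n : ℕ) (ν : Fin n → Measure ℝ)
    [∀ j, IsProbabilityMeasure (ν j)], (∀ j, IsStandardized (ν j)) →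
    ∀ (J : Finset (Fin n)) (s₀ b η : ℝ), 0 < s₀ → s₀ ≤ b → 0 < η →
    (∀ j ∈ J, s₀ ^ 2 * ∫ x, x ^ 4 ∂(ν j) ≤ 1 / 100) →
    (stdGaussianPi n).real {g | ENNReal.ofReal η < ∫⁻ s in Set.Ioc s₀ b,
      ‖∏ j, charFun (ν j) (s * g j)‖ₑ / ENNReal.ofReal s} ≤
      Real.exp (-(c * s₀ ^ 2 * J.card)) * (b / s₀) / η := by
  obtain ⟨c, hc, h⟩ := exists_lintegral_prod_charFun_le
  refine ⟨c, hc, fun n ν _ hν J s₀ b η hs₀ hb hη hJ => ?_⟩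
  exact measureReal_lintegral_div_tail (stdGaussianPi n) (measurable_norm_prod_charFun ν) hs₀ hb hη
    (Real.exp_pos _).le fun s hs => h n ν hν J s₀ s hs₀ hs hJ

/-! ### Comparison with the Gaussian characteristic function -/

/-- Away from the origin, the characteristic function of a sum decays like a Gaussian one, as long
as a fixed proportion of the mass of the direction `θ` lies on regular coordinates. -/
lemma norm_prod_charFun_le_exp {ι : Type*} [Fintype ι] (ν : ι → Measure ℝ)
    [∀ j, IsProbabilityMeasure (ν j)] (h : ∀ j, IsStandardized (ν j)) (θ : ι → ℝ) (G : Finset ι)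
    {ξ d : ℝ} (hG : ∀ j ∈ G, (ξ * θ j) ^ 2 * ∫ x, x ^ 4 ∂(ν j) ≤ 1 / 100)
    (hd : d ≤ ∑ j ∈ G, θ j ^ 2) :
    ‖∏ j, charFun (ν j) (ξ * θ j)‖ ≤ Real.exp (-(d / 4 * ξ ^ 2)) := by
  classical
  rw [norm_prod]
  calc ∏ j, ‖charFun (ν j) (ξ * θ j)‖
      ≤ ∏ j, if j ∈ G then Real.exp (-(ξ * θ j) ^ 2 / 4) else 1 := by
        refine Finset.prod_le_prod (fun j _ => norm_nonneg _) fun j _ => ?_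
        split_ifs with hj
        · refine ((h j).norm_charFun_le_one_sub (hG j hj)).trans ?_
          have := Real.add_one_le_exp (-(ξ * θ j) ^ 2 / 4)
          linarith
        · exact norm_charFun_le_one _
    _ ≤ _ := by
      rw [Finset.prod_ite_mem, Finset.univ_inter, ← Real.exp_sum, Real.exp_le_exp]
      have : ∑ j ∈ G, -(ξ * θ j) ^ 2 / 4 = -(ξ ^ 2 / 4 * ∑ j ∈ G, θ j ^ 2) := by
        rw [Finset.mul_sum, ← Finset.sum_neg_distrib]
        exact Finset.sum_congr rfl fun j _ => by ring
      rw [this]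
      nlinarith [sq_nonneg ξ]

lemma integrable_pow_mul_exp_neg_mul_sq {c : ℝ} (hc : 0 < c) (k : ℕ) :
    Integrable fun x : ℝ => x ^ k * Real.exp (-c * x ^ 2) := by
  have := integrable_rpow_mul_exp_neg_mul_sq hc (s := k)
    (by have : (0 : ℝ) ≤ k := Nat.cast_nonneg k
        linarith)
  simpa using this

/-- The distance between the characteristic function of `∑ θ_j X_j` and the Gaussian one, for a
regular direction `θ`. -/
lemma exists_lintegral_prod_charFun_sub_le (A d : ℝ) (hA : 1 ≤ A) (hd : 0 < d) (hd1 : d ≤ 1) :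
    ∃ C : ℝ, 0 < C ∧ ∀ (n : ℕ) (ν : Fin n → Measure ℝ)
    [∀ j, IsProbabilityMeasure (ν j)], (∀ j, IsStandardized (ν j)) →
    ∀ (θ : Fin n → ℝ) (G : Finset (Fin n)) (U κ : ℝ), 1 ≤ U → 1 / U ≤ κ → κ ≤ 1 →
      ∑ j, θ j ^ 2 = 1 → ∑ j, θ j ^ 4 * ∫ x, x ^ 4 ∂(ν j) ≤ κ →
      |∑ j, θ j ^ 3 * ∫ x, x ^ 3 ∂(ν j)| ≤ κ →
      (∀ j ∈ G, θ j ^ 2 * ∫ x, x ^ 4 ∂(ν j) ≤ A / U) → d ≤ ∑ j ∈ G, θ j ^ 2 →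
      ∫⁻ ξ in Set.Ioc (√(U / (100 * A))) U, ‖∏ j, charFun (ν j) (ξ * θ j)‖ₑ / ENNReal.ofReal ξ ≤
        ENNReal.ofReal (1 / U) →
      ∫⁻ ξ in Set.Ioc 0 U, ‖∏ j, charFun (ν j) (ξ * θ j) - Real.exp (-ξ ^ 2 / 2)‖ₑ /
        ENNReal.ofReal ξ ≤ ENNReal.ofReal (C * κ) := by
  -- The two summands of `B` pay for the crude bound 2 once `ξ ^ 4 * κ > 1 / 10000`, and for the
  -- Gaussian beyond `τ`. The powers in `f` are already divided by `ξ`.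
  set B : ℝ := 20000 + 10000 * A ^ 2 with hB
  set f : ℝ → ℝ := fun ξ => B * (ξ ^ 3 * Real.exp (-(d / 4) * ξ ^ 2)) +
    ξ ^ 2 * Real.exp (-(d / 4) * ξ ^ 2) with hf
  have hfi : Integrable f :=
    ((integrable_pow_mul_exp_neg_mul_sq (by positivity) 3).const_mul B).add
      (integrable_pow_mul_exp_neg_mul_sq (by positivity) 2)
  have hf0 : ∀ ξ : ℝ, 0 ≤ ξ → 0 ≤ f ξ := fun ξ hξ => by positivity
  have hI0 : 0 ≤ ∫ ξ in Set.Ioi (0 : ℝ), f ξ :=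
    setIntegral_nonneg measurableSet_Ioi fun ξ hξ => hf0 ξ (le_of_lt hξ)
  refine ⟨(∫ ξ in Set.Ioi (0 : ℝ), f ξ) + 1, by positivity, ?_⟩
  intro n ν _ hν θ G U κ hU hκ hκ1 hθ h4 h3 hG hGd htail
  have hU0 : 0 < U := by linarith
  have hκ0 : 0 < κ := lt_of_lt_of_le (by positivity) hκ
  -- With `θ_j² m_j ≤ A / U`, this is the frequency up to which `(ξ θ_j)² m_j ≤ 1 / 100` on `G`.
  set τ := √(U / (100 * A)) with hτ
  have hτ0 : 0 < τ := Real.sqrt_pos.2 (by positivity)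
  have hτ2 : τ ^ 2 = U / (100 * A) := Real.sq_sqrt (by positivity)
  have hgauss : ∀ ξ : ℝ, Real.exp (-ξ ^ 2 / 2) ≤ Real.exp (-(d / 4) * ξ ^ 2) := fun ξ => by
    rw [Real.exp_le_exp]
    nlinarith [sq_nonneg ξ]
  have hlow : ∀ ξ : ℝ, 0 < ξ → ξ ≤ τ →
      ‖∏ j, charFun (ν j) (ξ * θ j) - Real.exp (-ξ ^ 2 / 2)‖ ≤ κ * f ξ * ξ := by
    intro ξ hξ hξτ
    have hE := Real.exp_pos (-(d / 4) * ξ ^ 2)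
    by_cases hsmall : ξ ^ 4 * κ ≤ 1 / 10000
    · have hs : ∑ j, (ξ * θ j) ^ 2 = ξ ^ 2 := by
        simp_rw [mul_pow]
        rw [← Finset.mul_sum, hθ, mul_one]
      have h3' : ξ ^ 3 * κ ≤ 1 := by
        rcases le_total ξ 1 with h1 | h1
        · have := pow_le_one₀ hξ.le h1 (n := 3)
          nlinarith
        · have : ξ ^ 3 ≤ ξ ^ 4 := pow_le_pow_right₀ h1 (by norm_num)
          nlinarith
      have := norm_prod_charFun_sub_exp_le ν hν (fun j => ξ * θ j) (a := ξ ^ 4 * κ)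
        (b := ξ ^ 3 * κ) (by
          simp_rw [mul_pow, mul_assoc]
          rw [← Finset.mul_sum]
          gcongr) hsmall (by
          simp_rw [mul_pow, mul_assoc]
          rw [← Finset.mul_sum, abs_mul, abs_of_pos (by positivity)]
          gcongr) h3'
      rw [hs] at this
      refine this.trans ?_
      calc (20 * (ξ ^ 4 * κ) + ξ ^ 3 * κ) * Real.exp (-ξ ^ 2 / 2)
          ≤ (B * (ξ ^ 4 * κ) + ξ ^ 3 * κ) * Real.exp (-(d / 4) * ξ ^ 2) := by
            gcongr
            · rw [hB]; nlinarith
            · exact Real.exp_le_exp.1 (hgauss ξ)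
        _ = _ := by rw [hf]; ring
    · have h1 := norm_prod_charFun_le_exp ν hν θ G (ξ := ξ) (fun j hj => by
        have hm := (hν j).one_le_fourth_moment
        calc (ξ * θ j) ^ 2 * ∫ x, x ^ 4 ∂(ν j) = ξ ^ 2 * (θ j ^ 2 * ∫ x, x ^ 4 ∂(ν j)) := by ring
          _ ≤ τ ^ 2 * (A / U) := by
            gcongr
            exact hG j hj
          _ = _ := by rw [hτ2]; field_simp) hGd
      have h2 : ‖∏ j, charFun (ν j) (ξ * θ j) - Real.exp (-ξ ^ 2 / 2)‖ ≤
          2 * Real.exp (-(d / 4) * ξ ^ 2) := by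
        refine (norm_sub_le _ _).trans ?_
        rw [Complex.norm_real, Real.norm_of_nonneg (Real.exp_pos _).le, two_mul]
        refine add_le_add ?_ (hgauss ξ)
        rwa [neg_mul]
      refine h2.trans ?_
      calc 2 * Real.exp (-(d / 4) * ξ ^ 2)
          ≤ (20000 * (ξ ^ 4 * κ)) * Real.exp (-(d / 4) * ξ ^ 2) := by
            gcongr
            linarith
        _ ≤ (B * (ξ ^ 4 * κ) + ξ ^ 3 * κ) * Real.exp (-(d / 4) * ξ ^ 2) := by
            gcongr
            have : 0 ≤ ξ ^ 3 * κ := by positivity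
            have : 0 ≤ A ^ 2 * (ξ ^ 4 * κ) := by positivity
            rw [hB]
            linarith
        _ = _ := by rw [hf]; ring
  -- Here `ξ ^ 4` is at least `U ^ 2 / (10000 * A ^ 2)` and `U * κ ≥ 1`, so the Gaussian tail is
  -- also of order `κ`.
  have hhigh : ∀ ξ : ℝ, τ < ξ → Real.exp (-ξ ^ 2 / 2) ≤ κ * f ξ * ξ := by
    intro ξ hξτ
    have hξ : 0 < ξ := hτ0.trans hξτ
    have h1 : (U / (100 * A)) ^ 2 ≤ ξ ^ 4 := by
      rw [← hτ2, ← pow_mul]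
      gcongr
    have h2 : 1 ≤ 10000 * A ^ 2 * (ξ ^ 4 * κ) := by
      have h3 : 1 ≤ U * κ := by rwa [div_le_iff₀' hU0] at hκ
      have h4 : U ^ 2 ≤ 10000 * A ^ 2 * ξ ^ 4 := by
        rw [div_pow, div_le_iff₀ (by positivity)] at h1
        linarith
      calc (1 : ℝ) ≤ U * (U * κ) := by nlinarith
        _ = U ^ 2 * κ := by ring
        _ ≤ 10000 * A ^ 2 * ξ ^ 4 * κ := by gcongr
        _ = _ := by ring
    calc Real.exp (-ξ ^ 2 / 2) ≤ 1 * Real.exp (-(d / 4) * ξ ^ 2) := by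
          rw [one_mul]; exact hgauss ξ
      _ ≤ (B * (ξ ^ 4 * κ) + ξ ^ 3 * κ) * Real.exp (-(d / 4) * ξ ^ 2) := by
          gcongr
          have : 0 ≤ ξ ^ 3 * κ := by positivity
          have : 0 ≤ ξ ^ 4 * κ := by positivity
          rw [hB]
          linarith
      _ = _ := by rw [hf]; ring
  have hpt : ∀ ξ ∈ Set.Ioc 0 U,
      ‖∏ j, charFun (ν j) (ξ * θ j) - Real.exp (-ξ ^ 2 / 2)‖ₑ / ENNReal.ofReal ξ ≤
      ENNReal.ofReal (κ * f ξ) + (Set.Ioc τ U).indicator (fun ξ =>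
        ‖∏ j, charFun (ν j) (ξ * θ j)‖ₑ / ENNReal.ofReal ξ) ξ := by
    intro ξ hξ
    have hξ0 : ENNReal.ofReal ξ ≠ 0 := by simpa using hξ.1
    by_cases hξτ : ξ ≤ τ
    · refine le_trans ?_ le_self_add
      rw [ENNReal.div_le_iff hξ0 ENNReal.ofReal_ne_top, ← ENNReal.ofReal_mul
        (mul_nonneg hκ0.le (hf0 ξ hξ.1.le)), ← ofReal_norm]
      exact ENNReal.ofReal_le_ofReal (hlow ξ hξ.1 hξτ)
    · rw [not_le] at hξτ
      rw [Set.indicator_of_mem (show ξ ∈ Set.Ioc τ U from ⟨hξτ, hξ.2⟩),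
        ENNReal.div_le_iff hξ0 ENNReal.ofReal_ne_top, add_mul,
        ENNReal.div_mul_cancel hξ0 ENNReal.ofReal_ne_top, ← ENNReal.ofReal_mul
        (mul_nonneg hκ0.le (hf0 ξ hξ.1.le)), add_comm]
      refine (enorm_sub_le).trans ?_
      gcongr
      rw [← ofReal_norm, Complex.norm_real, Real.norm_of_nonneg (Real.exp_pos _).le]
      exact ENNReal.ofReal_le_ofReal (hhigh ξ hξτ)
  refine (setLIntegral_mono' measurableSet_Ioc hpt).trans ?_
  rw [lintegral_add_left (by fun_prop), lintegral_indicator measurableSet_Ioc,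
    Measure.restrict_restrict measurableSet_Ioc, add_mul, one_mul,
    ENNReal.ofReal_add (by positivity) hκ0.le]
  gcongr
  · calc _ ≤ ∫⁻ ξ in Set.Ioi 0, ENNReal.ofReal (κ * f ξ) :=
          lintegral_mono_set Set.Ioc_subset_Ioi_self
      _ = ENNReal.ofReal (∫ ξ in Set.Ioi 0, κ * f ξ) := by
          rw [ofReal_integral_eq_lintegral_ofReal (hfi.const_mul κ).integrableOn]
          exact (ae_restrict_iff' measurableSet_Ioi).2 (Filter.Eventually.of_forall fun ξ hξ =>
            mul_nonneg hκ0.le (hf0 ξ (le_of_lt hξ)))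
      _ = _ := by rw [integral_const_mul, mul_comm]
  · refine (lintegral_mono_set Set.inter_subset_left).trans (htail.trans ?_)
    exact ENNReal.ofReal_le_ofReal hκ

/-- The directions `θ` for which the normal approximation of `∑ θ_j X_j` is good, where `X_j` has
law `ν j`. -/
structure IsRegularDirection {n : ℕ} (ν : Fin n → Measure ℝ) (A d U κ : ℝ) (θ : Fin n → ℝ) :
    Prop where
  fourth : ∑ j, θ j ^ 4 * ∫ x, x ^ 4 ∂(ν j) ≤ κ
  third : |∑ j, θ j ^ 3 * ∫ x, x ^ 3 ∂(ν j)| ≤ κ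
  mass : d ≤ ∑ j, {x : ℝ | x ^ 2 * ∫ x, x ^ 4 ∂(ν j) ≤ A / U}.indicator (fun x => x ^ 2) (θ j)
  tail : ∫⁻ ξ in Set.Ioc (√(U / (100 * A))) U,
    ‖∏ j, charFun (ν j) (ξ * θ j)‖ₑ / ENNReal.ofReal ξ ≤ ENNReal.ofReal (1 / U)

lemma measurableSet_isRegularDirection {n : ℕ} (ν : Fin n → Measure ℝ)
    [∀ j, IsProbabilityMeasure (ν j)] (A d U κ : ℝ) :
    MeasurableSet {θ : Fin n → ℝ | IsRegularDirection ν A d U κ θ} := by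
  have hm : Measurable fun p : (Fin n → ℝ) × ℝ =>
      ‖∏ j, charFun (ν j) (p.2 * p.1 j)‖ₑ / ENNReal.ofReal p.2 :=
    ((measurable_norm_prod_charFun ν).comp measurable_swap).div (by fun_prop)
  have h1 : MeasurableSet {θ : Fin n → ℝ | ∑ j, θ j ^ 4 * ∫ x, x ^ 4 ∂(ν j) ≤ κ} :=
    measurableSet_le (by fun_prop) measurable_const
  have h2 : MeasurableSet {θ : Fin n → ℝ | |∑ j, θ j ^ 3 * ∫ x, x ^ 3 ∂(ν j)| ≤ κ} :=
    measurableSet_le (Measurable.abs (by fun_prop)) measurable_const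
  have h3 : MeasurableSet {θ : Fin n → ℝ | d ≤ ∑ j,
      {x : ℝ | x ^ 2 * ∫ x, x ^ 4 ∂(ν j) ≤ A / U}.indicator (fun x => x ^ 2) (θ j)} := by
    refine measurableSet_le measurable_const (Finset.measurable_fun_sum _ fun j _ => ?_)
    have : Measurable ({x : ℝ | x ^ 2 * ∫ x, x ^ 4 ∂(ν j) ≤ A / U}.indicator fun x => x ^ 2) :=
      (by fun_prop : Measurable fun x : ℝ => x ^ 2).indicator
        (measurableSet_le (by fun_prop) measurable_const)
    exact this.comp (measurable_pi_apply j)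
  have h4 : MeasurableSet {θ : Fin n → ℝ | ∫⁻ ξ in Set.Ioc (√(U / (100 * A))) U,
      ‖∏ j, charFun (ν j) (ξ * θ j)‖ₑ / ENNReal.ofReal ξ ≤ ENNReal.ofReal (1 / U)} :=
    measurableSet_le (Measurable.lintegral_prod_right' hm) measurable_const
  convert (h1.inter h2).inter (h3.inter h4) using 1
  ext θ
  exact ⟨fun h => ⟨⟨h.1, h.2⟩, ⟨h.3, h.4⟩⟩, fun h => ⟨h.1.1, h.1.2, h.2.1, h.2.2⟩⟩

/-! ### From Gaussian bounds to regular directions -/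

/-- Markov's inequality for the counting measure: fewer than half of the values can exceed twice the
average by much count, so half of the indices remain usable. -/
lemma card_fourth_moment_le {n : ℕ} (m : Fin n → ℝ) (hm : ∀ j, 0 < m j) :
    (n : ℝ) / 2 ≤ (({j | m j * n ≤ 2 * ∑ i, m i} : Finset (Fin n)).card : ℝ) := by
  set S := ∑ i, m i with hS
  rcases Nat.eq_zero_or_pos n with rfl | hn
  · simp
  have hn' : (0 : ℝ) < n := Nat.cast_pos.2 hn
  have : Nonempty (Fin n) := ⟨⟨0, hn⟩⟩
  have hS0 : 0 < S := Finset.sum_pos (fun j _ => hm j) Finset.univ_nonempty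
  have hcard : (({j | m j * n ≤ 2 * S} : Finset (Fin n)).card : ℝ) +
      (({j | ¬ m j * n ≤ 2 * S} : Finset (Fin n)).card : ℝ) = n := by
    have := Finset.card_filter_add_card_filter_not (s := Finset.univ)
      (fun j : Fin n => m j * n ≤ 2 * S)
    rw [Finset.card_univ, Fintype.card_fin] at this
    exact_mod_cast this
  have hle : (({j | ¬ m j * n ≤ 2 * S} : Finset (Fin n)).card : ℝ) * (2 * S) ≤ S * n := by
    rw [← nsmul_eq_mul, hS, Finset.sum_mul]
    refine (Finset.card_nsmul_le_sum _ (fun j => m j * n) _ fun j hj => ?_).trans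
      (Finset.sum_le_univ_sum_of_nonneg fun j => (mul_pos (hm j) hn').le)
    simp only [Finset.mem_filter, not_le] at hj
    exact hj.2.le
  nlinarith

/-- The sixth-moment and self-normalized bounds control a cubic form in the direction of `g`. -/
lemma abs_sum_cube_le_of_bounds {n : ℕ} (hn : 1 ≤ n) (γ : Fin n → ℝ) {ε S L : ℝ} {k : ℕ}
    (hε : 0 < ε) (hε1 : ε ≤ 1) (hnS : (n : ℝ) ≤ S)
    (hk1 : 1 ≤ k) (hkL : (k : ℝ) ≤ 5 * L) {g θ : Fin n → ℝ} {R : ℝ} (hR : 0 < R)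
    (hθ : ∀ j, θ j = g j / R) (hRlow : ε * n / 2 ≤ R ^ 2)
    (h4 : ∑ j, γ j ^ 2 * (g j ^ 2) ^ 3 ≤ Real.exp 1 * (12 * k) ^ 3 * S)
    (h5 : ∀ σ : ℝ, |σ| = 1 → ∑ j, (σ * (1 / (k * √S) * γ j * g j ^ 3) -
      (σ * (1 / (k * √S) * γ j * g j ^ 3)) ^ 2 / 2) ≤ (k : ℝ)) :
    |∑ j, θ j ^ 3 * γ j| ≤ 260000 / ε ^ 2 * L ^ 2 / (n ^ 2 / S) := by
  have hn0 : (0 : ℝ) < n := by exact_mod_cast hn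
  have hk0 : (1 : ℝ) ≤ k := by exact_mod_cast hk1
  have hS0 : 0 < S := hn0.trans_le hnS
  have hL0 : 0 < L := by linarith
  have hksq : (k : ℝ) ^ 2 ≤ 25 * L ^ 2 := by
    calc (k : ℝ) ^ 2 ≤ (5 * L) ^ 2 := by gcongr
      _ = _ := by ring
  have he3 : Real.exp 1 ≤ 3 := by linarith [Real.exp_one_lt_d9]
  set Y := ∑ j, γ j * g j ^ 3 with hY
  obtain ⟨r, hr0, hr2⟩ : ∃ r, 0 < r ∧ r ^ 2 = S := ⟨√S, Real.sqrt_pos.2 hS0, Real.sq_sqrt hS0.le⟩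
  have hrS : √S = r := by rw [← hr2, Real.sqrt_sq hr0.le]
  rw [hrS] at h5
  have hYσ : ∀ σ : ℝ, |σ| = 1 → σ * Y ≤ 2600 * k ^ 2 * r := by
    intro σ hσ
    have hσ2 : σ ^ 2 = 1 := by rw [← sq_abs, hσ, one_pow]
    have e : ∑ j, (σ * (1 / (k * r) * γ j * g j ^ 3) -
      (σ * (1 / (k * r) * γ j * g j ^ 3)) ^ 2 / 2) =
      (σ * Y) / (k * r) - (∑ j, γ j ^ 2 * (g j ^ 2) ^ 3) / (2 * (k ^ 2 * S)) := by
      rw [Finset.sum_sub_distrib, hY, Finset.mul_sum, Finset.sum_div, Finset.sum_div]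
      congr 1
      · exact Finset.sum_congr rfl fun j _ => by ring
      · refine Finset.sum_congr rfl fun j _ => ?_
        rw [mul_pow σ, hσ2, ← hr2]
        field_simp
    have h5' := h5 σ hσ
    rw [e] at h5'
    -- With normalization `1 / (k * √S)` the quadratic correction is also of order `k`; `1 + 2592 ≤
    -- 2600`.
    have hV : (∑ j, γ j ^ 2 * (g j ^ 2) ^ 3) / (2 * (k ^ 2 * S)) ≤ 2592 * k := by
      rw [div_le_iff₀ (by positivity)]
      calc _ ≤ _ := h4
        _ ≤ 3 * (12 * k) ^ 3 * S := by gcongr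
        _ = _ := by ring
    have h7 : σ * Y / (k * r) ≤ 2600 * k := by linarith
    rw [div_le_iff₀ (by positivity)] at h7
    calc _ ≤ _ := h7
      _ = _ := by ring
  have hYabs : |Y| ≤ 2600 * k ^ 2 * r := by
    rw [abs_le']
    exact ⟨by simpa using hYσ 1 (by simp), by simpa using hYσ (-1) (by simp)⟩
  have e : ∑ j, θ j ^ 3 * γ j = Y / R ^ 3 := by
    rw [hY, Finset.sum_div]
    exact Finset.sum_congr rfl fun j _ => by rw [hθ]; ring
  -- This is where `n ≤ S` enters: it turns `√S / R ^ 3` into a multiple of `S / n ^ 2`.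
  have hRS : ε * n / 2 ≤ R * r := by
    refine le_of_sq_le_sq ?_ (by positivity)
    rw [mul_pow, hr2]
    calc (ε * n / 2) ^ 2 = (ε * n / 2) * (ε / 2 * n) := by ring
      _ ≤ R ^ 2 * (1 * S) := by gcongr; linarith
      _ = _ := by ring
  have hR3 : ε ^ 2 * n ^ 2 / 4 * r ≤ R ^ 3 * S := by
    calc ε ^ 2 * n ^ 2 / 4 * r = (ε * n / 2) * (ε * n / 2) * r := by ring
      _ ≤ R ^ 2 * (R * r) * r := by gcongr
      _ = R ^ 3 * r ^ 2 := by ring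
      _ = _ := by rw [hr2]
  rw [e, abs_div, abs_of_pos (by positivity : 0 < R ^ 3), div_le_iff₀ (by positivity)]
  calc |Y| ≤ 2600 * k ^ 2 * r := hYabs
    _ ≤ 2600 * (25 * L ^ 2) * r := by gcongr
    _ = 260000 / ε ^ 2 * L ^ 2 / n ^ 2 * (ε ^ 2 * n ^ 2 / 4 * r) := by field_simp; norm_num
    _ ≤ 260000 / ε ^ 2 * L ^ 2 / n ^ 2 * (R ^ 3 * S) := by gcongr
    _ = _ := by field_simp

lemma sum_fourth_le_of_bounds {n : ℕ} (hn : 1 ≤ n) (m : Fin n → ℝ) {ε S L : ℝ} {k : ℕ}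
    (hε : 0 < ε) (hS0 : 0 < S) (hkL : (k : ℝ) ≤ 5 * L) {g θ : Fin n → ℝ} {R : ℝ}
    (hθ : ∀ j, θ j = g j / R) (hRlow : ε * n / 2 ≤ R ^ 2)
    (h3 : ∑ j, m j * (g j ^ 2) ^ 2 ≤ Real.exp 1 * (8 * k) ^ 2 * S) :
    ∑ j, θ j ^ 4 * m j ≤ 260000 / ε ^ 2 * L ^ 2 / (n ^ 2 / S) := by
  have hn0 : (0 : ℝ) < n := by exact_mod_cast hn
  have hksq : (k : ℝ) ^ 2 ≤ 25 * L ^ 2 := by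
    calc (k : ℝ) ^ 2 ≤ (5 * L) ^ 2 := by gcongr
      _ = _ := by ring
  have he3 : Real.exp 1 ≤ 3 := by linarith [Real.exp_one_lt_d9]
  have e : ∑ j, θ j ^ 4 * m j = (∑ j, m j * (g j ^ 2) ^ 2) / (R ^ 2) ^ 2 := by
    rw [Finset.sum_div]
    exact Finset.sum_congr rfl fun j _ => by rw [hθ]; ring
  rw [e]
  calc _ ≤ (Real.exp 1 * (8 * k) ^ 2 * S) / (ε * n / 2) ^ 2 := by gcongr
    _ = Real.exp 1 * 256 * k ^ 2 / ε ^ 2 / (n ^ 2 / S) := by field_simp; ring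
    _ ≤ 3 * 256 * (25 * L ^ 2) / ε ^ 2 / (n ^ 2 / S) := by gcongr
    _ = 19200 / ε ^ 2 * L ^ 2 / (n ^ 2 / S) := by ring
    _ ≤ _ := by gcongr; norm_num

/-- A coordinate with `1 ≤ g_j² ≤ 4` and moderate fourth moment carries mass at least `1 / R²`, yet
is small enough to be regular; a fixed proportion of the coordinates is of this kind. -/
lemma mass_le_of_bounds {n : ℕ} (hn : 1 ≤ n) (m : Fin n → ℝ) (hm0 : ∀ j, 0 ≤ m j) {ε S : ℝ}
    (hε : 0 < ε) (hS0 : 0 < S) {g θ : Fin n → ℝ} {R : ℝ} (hR : 0 < R)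
    (hθ : ∀ j, θ j = g j / R) (hRlow : ε * n / 2 ≤ R ^ 2) (hRup : R ^ 2 ≤ 8 * n)
    (h2 : ε * (n / 2) ≤ ∑ j with m j * n ≤ 2 * S, (Set.Icc (1 : ℝ) 4).indicator 1 (g j ^ 2)) :
    ε / 16 ≤ ∑ j, {x : ℝ | x ^ 2 * m j ≤ 16 / ε / (n ^ 2 / S)}.indicator (fun x => x ^ 2) (θ j) := by
  have hn0 : (0 : ℝ) < n := by exact_mod_cast hn
  have hterm : ∀ j, m j * n ≤ 2 * S → (Set.Icc (1 : ℝ) 4).indicator 1 (g j ^ 2) / R ^ 2 ≤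
      {x : ℝ | x ^ 2 * m j ≤ 16 / ε / (n ^ 2 / S)}.indicator (fun x => x ^ 2) (θ j) := by
    intro j hj
    by_cases hgj : g j ^ 2 ∈ Set.Icc (1 : ℝ) 4
    · have hmem : θ j ∈ {x : ℝ | x ^ 2 * m j ≤ 16 / ε / (n ^ 2 / S)} := by
        have hmj : m j ≤ 2 * S / n := by rwa [le_div_iff₀ hn0]
        have h4 := hgj.2
        have := hm0 j
        show θ j ^ 2 * m j ≤ 16 / ε / (n ^ 2 / S)
        rw [hθ, div_pow]
        calc g j ^ 2 / R ^ 2 * m j ≤ 4 / (ε * n / 2) * (2 * S / n) := by gcongr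
          _ = _ := by field_simp; norm_num
      have h1 := hgj.1
      rw [Set.indicator_of_mem hmem, Set.indicator_of_mem hgj, hθ, div_pow, Pi.one_apply]
      gcongr
    · rw [Set.indicator_of_notMem hgj, zero_div]
      exact Set.indicator_nonneg (fun x _ => sq_nonneg x) _
  obtain ⟨w, hw⟩ : ∃ w : Fin n → ℝ, ∀ j, w j = {x : ℝ | x ^ 2 * m j ≤ 16 / ε /
      (n ^ 2 / S)}.indicator (fun x => x ^ 2) (θ j) := ⟨_, fun j => rfl⟩
  have hw0 : ∀ j, 0 ≤ w j := fun j => by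
    rw [hw]
    exact Set.indicator_nonneg (fun x _ => sq_nonneg x) _
  simp_rw [← hw] at hterm ⊢
  obtain ⟨v, hv⟩ : ∃ v : Fin n → ℝ, ∀ j, v j = (Set.Icc (1 : ℝ) 4).indicator 1 (g j ^ 2) :=
    ⟨_, fun j => rfl⟩
  simp_rw [← hv] at hterm h2
  calc ε / 16 = ε * (n / 2) / (8 * n) := by field_simp; norm_num
    _ ≤ ε * (n / 2) / R ^ 2 := by gcongr
    _ ≤ (∑ j with m j * n ≤ 2 * S, v j) / R ^ 2 := div_le_div_of_nonneg_right h2 (sq_nonneg R)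
    _ = ∑ j with m j * n ≤ 2 * S, v j / R ^ 2 := Finset.sum_div _ _ _
    _ ≤ ∑ j with m j * n ≤ 2 * S, w j :=
      Finset.sum_le_sum fun j hj => hterm j (Finset.mem_filter.1 hj).2
    _ ≤ _ := Finset.sum_le_univ_sum_of_nonneg hw0

/-- Since `ds / s` is scale invariant, normalizing `g` only moves the range of integration.
Enlarging it to one independent of `g` allows Markov's inequality for `g` itself. -/
lemma lintegral_tail_le_of_bounds {n : ℕ} (ν : Fin n → Measure ℝ)
    [∀ j, IsProbabilityMeasure (ν j)] {r₁ r₂ τ U : ℝ} (hr₁ : 0 < r₁) (hτ : 0 ≤ τ) (hU : 0 ≤ U)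
    {g θ : Fin n → ℝ} {R : ℝ} (hR : 0 < R) (hθ : ∀ j, θ j = g j / R)
    (hRlow : r₁ ≤ R) (hRup : R ≤ r₂) :
    ∫⁻ ξ in Set.Ioc τ U, ‖∏ j, charFun (ν j) (ξ * θ j)‖ₑ / ENNReal.ofReal ξ ≤
      ∫⁻ s in Set.Ioc (τ / r₂) (U / r₁), ‖∏ j, charFun (ν j) (s * g j)‖ₑ / ENNReal.ofReal s := by
  have hm : Measurable fun s : ℝ => ‖∏ j, charFun (ν j) (s * g j)‖ₑ :=
    Measurable.enorm (Finset.measurable_fun_prod _ fun j _ =>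
      measurable_charFun.comp (measurable_mul_const (g j)))
  have hsc := lintegral_div_comp_mul_left (inv_pos.2 hR) _ hm τ U
  have e : ∀ ξ : ℝ, ∏ j, charFun (ν j) (ξ * θ j) = ∏ j, charFun (ν j) (R⁻¹ * ξ * g j) :=
    fun ξ => Finset.prod_congr rfl fun j _ => by rw [hθ]; congr 1; ring
  simp_rw [e]
  rw [hsc]
  refine lintegral_mono_set (Set.Ioc_subset_Ioc ?_ ?_)
  · rw [inv_mul_eq_div]
    gcongr
  · rw [inv_mul_eq_div]
    gcongr

/-- The bounds on a Gaussian vector `g` which make its direction regular. -/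
lemma isRegularDirection_of_gaussian_bounds {n : ℕ} (hn : 1 ≤ n) (ν : Fin n → Measure ℝ)
    [∀ j, IsProbabilityMeasure (ν j)] (hν : ∀ j, IsStandardized (ν j)) {ε S U L : ℝ} {k : ℕ}
    (hε : 0 < ε) (hε1 : ε ≤ 1) (hS : S = ∑ j, ∫ x, x ^ 4 ∂(ν j)) (hU : U = n ^ 2 / S)
    (hk1 : 1 ≤ k) (hkL : (k : ℝ) ≤ 5 * L)
    {g θ : Fin n → ℝ} {R : ℝ} (hR : 0 < R) (hR2 : R ^ 2 = ∑ j, g j ^ 2)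
    (hθ : ∀ j, θ j = g j / R)
    (h1 : ∑ j, g j ^ 2 ≤ 8 * n)
    (h2 : ε * (n / 2) ≤ ∑ j with (∫ x, x ^ 4 ∂(ν j)) * n ≤ 2 * S,
      (Set.Icc (1 : ℝ) 4).indicator 1 (g j ^ 2))
    (h3 : ∑ j, (∫ x, x ^ 4 ∂(ν j)) * (g j ^ 2) ^ 2 ≤ Real.exp 1 * (8 * k) ^ 2 * S)
    (h4 : ∑ j, (∫ x, x ^ 3 ∂(ν j)) ^ 2 * (g j ^ 2) ^ 3 ≤ Real.exp 1 * (12 * k) ^ 3 * S)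
    (h5 : ∀ σ : ℝ, |σ| = 1 → ∑ j, (σ * (1 / (k * √S) * (∫ x, x ^ 3 ∂(ν j)) * g j ^ 3) -
      (σ * (1 / (k * √S) * (∫ x, x ^ 3 ∂(ν j)) * g j ^ 3)) ^ 2 / 2) ≤ (k : ℝ))
    (h6 : ∫⁻ s in Set.Ioc (√(U / (100 * (16 / ε))) / √(8 * n)) (U / √(ε * n / 2)),
      ‖∏ j, charFun (ν j) (s * g j)‖ₑ / ENNReal.ofReal s ≤ ENNReal.ofReal (1 / U)) :
    IsRegularDirection ν (16 / ε) (ε / 16) U (260000 / ε ^ 2 * L ^ 2 / U) θ := by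
  have hn0 : (0 : ℝ) < n := by exact_mod_cast hn
  have hm1 := fun j => (hν j).one_le_fourth_moment
  have hnS : (n : ℝ) ≤ S := by
    rw [hS]
    calc (n : ℝ) = ∑ _j : Fin n, (1 : ℝ) := by simp
      _ ≤ _ := Finset.sum_le_sum fun j _ => hm1 j
  have hS0 : 0 < S := hn0.trans_le hnS
  have hU0 : 0 < U := by rw [hU]; positivity
  have hφle : ∀ x : ℝ, (Set.Icc (1 : ℝ) 4).indicator 1 (x ^ 2) ≤ x ^ 2 := fun x => by
    by_cases hx : x ^ 2 ∈ Set.Icc (1 : ℝ) 4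
    · rw [Set.indicator_of_mem hx]
      exact hx.1
    · rw [Set.indicator_of_notMem hx]
      exact sq_nonneg x
  have hRlow : ε * n / 2 ≤ R ^ 2 := by
    rw [hR2]
    calc ε * n / 2 = ε * (n / 2) := by ring
      _ ≤ _ := h2
      _ ≤ ∑ j with (∫ x, x ^ 4 ∂(ν j)) * n ≤ 2 * S, g j ^ 2 :=
        Finset.sum_le_sum fun j _ => hφle (g j)
      _ ≤ _ := Finset.sum_le_univ_sum_of_nonneg fun j => sq_nonneg _
  have hRup : R ^ 2 ≤ 8 * n := hR2 ▸ h1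
  refine ⟨?_, ?_, ?_, ?_⟩
  · rw [hU]
    exact sum_fourth_le_of_bounds hn _ hε hS0 hkL hθ hRlow h3
  · rw [hU]
    exact abs_sum_cube_le_of_bounds hn _ hε hε1 hnS hk1 hkL hR hθ hRlow h4 h5
  · rw [hU]
    exact mass_le_of_bounds hn _ (fun j => by linarith [hm1 j]) hε hS0 hR hθ hRlow hRup h2
  · refine (lintegral_tail_le_of_bounds ν (Real.sqrt_pos.2 (by positivity)) (Real.sqrt_nonneg _)
      hU0.le hR hθ ((Real.sqrt_le_left hR.le).2 hRlow) (Real.le_sqrt_of_sq_le hRup)).trans h6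

lemma exists_sq_mul_exp_neg_le {c B : ℝ} (hc : 0 < c) :
    ∃ C : ℝ, ∀ U, C ≤ U → B * U ^ 2 * Real.exp (-(c * U)) ≤ 1 := by
  have h := (Real.tendsto_pow_mul_exp_neg_atTop_nhds_zero 2).const_mul (B / c ^ 2)
  rw [mul_zero] at h
  have h2 := h.comp (Filter.tendsto_id.const_mul_atTop hc)
  obtain ⟨C, hC⟩ := Filter.eventually_atTop.1 (h2.eventually (gt_mem_nhds one_pos))
  refine ⟨C, fun U hU => (le_of_eq ?_).trans (hC U hU).le⟩
  simp only [Function.comp_apply, id]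
  field_simp

/-- The probability that one of the bounds that make a Gaussian direction regular fails. -/
lemma exists_gaussian_bounds_tail : ∃ ε : ℝ, 0 < ε ∧ ε ≤ 1 ∧ ∃ c : ℝ, 0 < c ∧
    ∀ (n : ℕ), 1 ≤ n → ∀ (ν : Fin n → Measure ℝ) [∀ j, IsProbabilityMeasure (ν j)],
    (∀ j, IsStandardized (ν j)) → ∀ (S U L : ℝ), S = ∑ j, ∫ x, x ^ 4 ∂(ν j) → U = n ^ 2 / S →
    1 ≤ U → 1 ≤ L → ∃ G : Set (Fin n → ℝ),
      (stdGaussianPi n).real G ≤ Real.exp (-n) + Real.exp (-(ε * (n / 2))) +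
        6 * Real.exp (-(L + 3)) + 160 / ε * U ^ 2 * Real.exp (-(c * U)) ∧
      ∀ (g : Fin n → ℝ) (θ : Fin n → ℝ) (R : ℝ), 0 < R → R ^ 2 = ∑ j, g j ^ 2 →
        (∀ j, θ j = g j / R) → g ∉ G →
        IsRegularDirection ν (16 / ε) (ε / 16) U (260000 / ε ^ 2 * L ^ 2 / U) θ := by
  obtain ⟨ε, hε, hε1, hcount⟩ := exists_stdGaussianPi_count_tail
  obtain ⟨c, hc, htail⟩ := exists_prod_charFun_tail
  refine ⟨ε, hε, hε1, c * ε / 25600, by positivity, ?_⟩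
  intro n hn ν _ hν S U L hS hU hU1 hL
  have hn0 : (0 : ℝ) < n := by exact_mod_cast hn
  have hm1 := fun j => (hν j).one_le_fourth_moment
  have hnS : (n : ℝ) ≤ S := by
    rw [hS]
    calc (n : ℝ) = ∑ _j : Fin n, (1 : ℝ) := by simp
      _ ≤ _ := Finset.sum_le_sum fun j _ => hm1 j
  have hS0 : 0 < S := hn0.trans_le hnS
  have hU0 : 0 < U := by linarith
  -- The extra 3 absorbs the number of bad events, since `9 ≤ exp 3`; `L ≥ 1` keeps `k ≤ 5 * L`.
  set k : ℕ := ⌈L⌉₊ + 3 with hk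
  have hkL3 : L + 3 ≤ k := by
    rw [hk]; push_cast; linarith [Nat.le_ceil L]
  have hkL5 : (k : ℝ) ≤ 5 * L := by
    rw [hk]; push_cast; linarith [Nat.ceil_lt_add_one (by linarith : 0 ≤ L)]
  have hk1 : 1 ≤ k := by omega
  have hexpk : Real.exp (-(k : ℝ)) ≤ Real.exp (-(L + 3)) := Real.exp_le_exp.2 (by linarith)
  set J : Finset (Fin n) := {j | (∫ x, x ^ 4 ∂(ν j)) * n ≤ 2 * S} with hJ
  have hJcard : (n : ℝ) / 2 ≤ J.card := by
    have := card_fourth_moment_le (fun j => ∫ x, x ^ 4 ∂(ν j)) fun j => by linarith [hm1 j]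
    rw [← hS] at this
    exact this
  set f : ℝ → Fin n → ℝ → ℝ := fun σ j x =>
    σ * (1 / (k * √S) * (∫ x, x ^ 3 ∂(ν j)) * x ^ 3) with hf
  set a := √(U / (100 * (16 / ε))) / √(8 * n) with ha
  set b := U / √(ε * n / 2) with hb
  have ha0 : 0 < a := by positivity
  -- `a²` is of order `U / n`: small enough for `a² m_j ≤ 1 / 100` on `J`, large enough that `a² *
  -- J.card` is of order `U`.
  have ha2 : a ^ 2 = U * ε / (12800 * n) := by
    rw [ha, div_pow, Real.sq_sqrt (by positivity), Real.sq_sqrt (by positivity)]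
    field_simp
    norm_num
  have hb0 : 0 < b := by positivity
  have hb2 : b ^ 2 = 2 * U ^ 2 / (ε * n) := by
    rw [hb, div_pow, Real.sq_sqrt (by positivity)]
    field_simp
  have hab : a ≤ b := by
    refine le_of_sq_le_sq ?_ hb0.le
    rw [ha2, hb2, div_le_div_iff₀ (by positivity) (by positivity)]
    calc U * ε * (ε * n) ≤ U * 1 * (1 * n) := by gcongr
      _ = U * n * 1 := by ring
      _ ≤ U * n * (25600 * U) := by gcongr; linarith
      _ = _ := by ring
  have hba : b / a ≤ 160 / ε * U := by
    rw [div_le_iff₀ ha0]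
    refine le_of_sq_le_sq ?_ (by positivity)
    rw [hb2, mul_pow, ha2]
    have : (160 / ε * U) ^ 2 * (U * ε / (12800 * n)) = 2 * U ^ 2 / (ε * n) * U := by
      field_simp; norm_num
    rw [this]
    exact le_mul_of_one_le_right (by positivity) hU1
  refine ⟨{g | 8 * n ≤ ∑ j, g j ^ 2} ∪
    {g | ∑ j ∈ J, (Set.Icc (1 : ℝ) 4).indicator 1 (g j ^ 2) ≤ ε * (J.card : ℝ)} ∪
    {g | Real.exp 1 * (4 * ((2 : ℕ) * k)) ^ 2 * ∑ j, ∫ x, x ^ 4 ∂(ν j) <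
      ∑ j, (∫ x, x ^ 4 ∂(ν j)) * (g j ^ 2) ^ 2} ∪
    {g | Real.exp 1 * (4 * ((3 : ℕ) * k)) ^ 3 * ∑ j, (∫ x, x ^ 3 ∂(ν j)) ^ 2 <
      ∑ j, (∫ x, x ^ 3 ∂(ν j)) ^ 2 * (g j ^ 2) ^ 3} ∪
    {g | (k : ℝ) ≤ ∑ j, (f 1 j (g j) - f 1 j (g j) ^ 2 / 2)} ∪
    {g | (k : ℝ) ≤ ∑ j, (f (-1) j (g j) - f (-1) j (g j) ^ 2 / 2)} ∪
    {g | ENNReal.ofReal (1 / U) < ∫⁻ s in Set.Ioc a b,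
      ‖∏ j, charFun (ν j) (s * g j)‖ₑ / ENNReal.ofReal s}, ?_, ?_⟩
  · have b1 := stdGaussianPi_norm_sq_tail n
    have b2 := hcount n J
    have b3 := stdGaussianPi_sum_pow_tail (fun j => ∫ x, x ^ 4 ∂(ν j))
      (fun j => by linarith [hm1 j]) (p := 2) (k := k) (by norm_num) hk1
    have b4 := stdGaussianPi_sum_pow_tail (fun j => (∫ x, x ^ 3 ∂(ν j)) ^ 2)
      (fun j => sq_nonneg _) (p := 3) (k := k) (by norm_num) hk1
    have b5 : ∀ σ : ℝ, (stdGaussianPi n).real {g | (k : ℝ) ≤ ∑ j, (f σ j (g j) -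
        f σ j (g j) ^ 2 / 2)} ≤ Real.exp (-k) := fun σ =>
      stdGaussianPi_odd_tail (f σ) (fun j => by simp only [hf]; fun_prop)
        (fun j x => by simp only [hf]; ring) k
    have b6 := htail n ν hν J a b (1 / U) ha0 hab (by positivity) fun j hj => by
      have hj' := (Finset.mem_filter.1 hj).2
      have hmj : ∫ x, x ^ 4 ∂(ν j) ≤ 2 * S / n := by rwa [le_div_iff₀ hn0]
      rw [ha2]
      calc U * ε / (12800 * n) * ∫ x, x ^ 4 ∂(ν j) ≤ U * 1 / (12800 * n) * (2 * S / n) := by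
            gcongr
        _ = 1 / 6400 := by rw [hU]; field_simp; norm_num
        _ ≤ _ := by norm_num
    have c2 : Real.exp (-(ε * J.card)) ≤ Real.exp (-(ε * (n / 2))) :=
      Real.exp_le_exp.2 (neg_le_neg (by gcongr))
    have c6 : Real.exp (-(c * a ^ 2 * J.card)) * (b / a) / (1 / U) ≤
        160 / ε * U ^ 2 * Real.exp (-(c * ε / 25600 * U)) := by
      have : Real.exp (-(c * a ^ 2 * J.card)) ≤ Real.exp (-(c * ε / 25600 * U)) := by
        refine Real.exp_le_exp.2 (neg_le_neg ?_)
        calc c * ε / 25600 * U = c * a ^ 2 * (n / 2) := by rw [ha2]; field_simp; norm_num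
          _ ≤ _ := by gcongr
      calc _ ≤ Real.exp (-(c * ε / 25600 * U)) * (160 / ε * U) / (1 / U) := by gcongr
        _ = _ := by field_simp
    have b51 := b5 1
    have b52 := b5 (-1)
    refine (measureReal_union_le _ _).trans ?_
    refine (add_le_add_left (measureReal_union_le _ _) _).trans ?_
    refine (add_le_add_left (add_le_add_left (measureReal_union_le _ _) _) _).trans ?_
    refine (add_le_add_left (add_le_add_left (add_le_add_left
      (measureReal_union_le _ _) _) _) _).trans ?_
    refine (add_le_add_left (add_le_add_left (add_le_add_left (add_le_add_left
      (measureReal_union_le _ _) _) _) _) _).trans ?_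
    refine (add_le_add_left (add_le_add_left (add_le_add_left (add_le_add_left (add_le_add_left
      (measureReal_union_le _ _) _) _) _) _) _).trans ?_
    refine (add_le_add (add_le_add (add_le_add (add_le_add (add_le_add (add_le_add b1
      (b2.trans c2)) b3) b4) b51) b52) (b6.trans c6)).trans ?_
    linarith
  · intro g θ R hR hR2 hθ hg
    simp only [Set.mem_union, Set.mem_ofPred_eq, not_or, not_lt, not_le] at hg
    obtain ⟨⟨⟨⟨⟨⟨g1, g2⟩, g3⟩, g4⟩, g5⟩, g5'⟩, g6⟩ := hg
    have e2 : (4 * (((2 : ℕ) : ℝ) * k)) = 8 * k := by push_cast; ring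
    have e3 : (4 * (((3 : ℕ) : ℝ) * k)) = 12 * k := by push_cast; ring
    rw [e2, ← hS] at g3
    rw [e3] at g4
    refine isRegularDirection_of_gaussian_bounds hn ν hν hε hε1 hS hU hk1 hkL5 hR hR2 hθ g1.le
      ?_ g3 ?_ ?_ g6
    · exact (mul_le_mul_of_nonneg_left hJcard hε.le).trans g2.le
    · refine g4.trans ?_
      gcongr
      rw [hS]
      exact Finset.sum_le_sum fun j _ => (hν j).sq_third_moment_le
    · intro σ hσ
      rcases eq_or_eq_neg_of_abs_eq hσ with rfl | rfl
      · exact g5.le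
      · exact g5'.le

lemma exists_sphereUniform_not_isRegularDirection_le : ∃ ε : ℝ, 0 < ε ∧ ε ≤ 1 ∧ ∃ C : ℝ, 1 ≤ C ∧
    ∀ (n : ℕ), 1 ≤ n → ∀ (ν : Fin n → Measure ℝ) [∀ j, IsProbabilityMeasure (ν j)],
    (∀ j, IsStandardized (ν j)) → ∀ (U L : ℝ), U = n ^ 2 / ∑ j, ∫ x, x ^ 4 ∂(ν j) →
    1 ≤ L → C * L ≤ U →
      sphereUniform n {θ | ¬ IsRegularDirection ν (16 / ε) (ε / 16) U
        (260000 / ε ^ 2 * L ^ 2 / U) θ.1} ≤ ENNReal.ofReal (Real.exp (-L)) := by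
  obtain ⟨ε, hε, hε1, c, hc, h⟩ := exists_gaussian_bounds_tail
  obtain ⟨C₀, hC₀⟩ := exists_sq_mul_exp_neg_le (B := 160 / ε) (half_pos hc)
  -- As `C * L ≤ U ≤ n` and `L + 3 ≤ 4 * L`, the entries 4, `8 / ε` and `8 / c` make every exponent
  -- at least `L + 3`. With `C₀`, half of `exp(-cU)` absorbs the factor `U ^ 2`.
  refine ⟨ε, hε, hε1, max 4 (max C₀ (max (8 / ε) (8 / c))), le_max_of_le_left (by norm_num), ?_⟩
  intro n hn ν _ hν U L hU hL hCU
  set C := max 4 (max C₀ (max (8 / ε) (8 / c))) with hC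
  have hC4 : 4 ≤ C := le_max_left _ _
  have hCC₀ : C₀ ≤ C := (le_max_left _ _).trans (le_max_right _ _)
  have hCε : 8 / ε ≤ C := ((le_max_left _ _).trans (le_max_right _ _)).trans (le_max_right _ _)
  have hCc : 8 / c ≤ C := ((le_max_right _ _).trans (le_max_right _ _)).trans (le_max_right _ _)
  have hCU1 : C ≤ U := (le_mul_of_one_le_right (by linarith) hL).trans hCU
  have hU1 : 1 ≤ U := by linarith
  have hn0 : (0 : ℝ) < n := by exact_mod_cast hn
  obtain ⟨G, hG, hreg⟩ := h n hn ν hν _ U L rfl hU hU1 hL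
  have hUn : U ≤ n := by
    have hnS : (n : ℝ) ≤ ∑ j, ∫ x, x ^ 4 ∂(ν j) := by
      calc (n : ℝ) = ∑ _j : Fin n, (1 : ℝ) := by simp
        _ ≤ _ := Finset.sum_le_sum fun j _ => (hν j).one_le_fourth_moment
    rw [hU, div_le_iff₀ (hn0.trans_le hnS)]
    nlinarith
  have hmeas : MeasurableSet {θ : UnitSphere n | ¬ IsRegularDirection ν (16 / ε) (ε / 16) U
        (260000 / ε ^ 2 * L ^ 2 / U) θ.1} :=
    ((measurableSet_isRegularDirection ν (16 / ε) (ε / 16) U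
      (260000 / ε ^ 2 * L ^ 2 / U)).preimage (f := fun θ : UnitSphere n => θ.1.ofLp)
      (by fun_prop)).compl
  refine (sphereUniform_le_stdGaussianPi hn hmeas (G := G) fun g θ hθ hpos hθg => ?_).trans ?_
  · by_contra hgG
    exact hθ (hreg g θ.1 _ hpos (by rw [EuclideanSpace.real_norm_sq_eq]) hθg hgG)
  · rw [← ofReal_measureReal]
    refine ENNReal.ofReal_le_ofReal (hG.trans ?_)
    have d1 : Real.exp (-n) ≤ Real.exp (-(L + 3)) := Real.exp_le_exp.2 (by nlinarith)
    have d2 : Real.exp (-(ε * (n / 2))) ≤ Real.exp (-(L + 3)) := by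
      refine Real.exp_le_exp.2 (neg_le_neg ?_)
      have h8 : 8 ≤ C * ε := by rwa [div_le_iff₀ hε] at hCε
      calc L + 3 ≤ 8 * L / 2 := by linarith
        _ ≤ (C * ε) * L / 2 := by gcongr
        _ = ε * (C * L / 2) := by ring
        _ ≤ _ := by gcongr; linarith
    have d3 : 160 / ε * U ^ 2 * Real.exp (-(c * U)) ≤ Real.exp (-(L + 3)) := by
      have e1 : Real.exp (-(c * U)) = Real.exp (-(c / 2 * U)) * Real.exp (-(c / 2 * U)) := by
        rw [← Real.exp_add]; ring_nf
      have e2 : Real.exp (-(c / 2 * U)) ≤ Real.exp (-(L + 3)) := by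
        refine Real.exp_le_exp.2 (neg_le_neg ?_)
        have h8 : 8 ≤ C * c := by rwa [div_le_iff₀ hc] at hCc
        calc L + 3 ≤ 8 * L / 2 := by linarith
          _ ≤ (C * c) * L / 2 := by gcongr
          _ = c / 2 * (C * L) := by ring
          _ ≤ _ := by gcongr
      calc _ = (160 / ε * U ^ 2 * Real.exp (-(c / 2 * U))) * Real.exp (-(c / 2 * U)) := by
            rw [e1]; ring
        _ ≤ 1 * Real.exp (-(L + 3)) := by
            gcongr
            exact hC₀ U (hCC₀.trans hCU1)
        _ = _ := one_mul _
    have d4 : 9 * Real.exp (-(L + 3)) ≤ Real.exp (-L) := by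
      have h9 : (9 : ℝ) ≤ Real.exp 3 := by
        have := Real.exp_one_gt_d9
        have e3 : Real.exp 3 = Real.exp 1 ^ 3 := by rw [← Real.exp_nat_mul]; norm_num
        rw [e3]
        calc (9 : ℝ) ≤ 2.5 ^ 3 := by norm_num
          _ ≤ _ := by gcongr; linarith
      calc 9 * Real.exp (-(L + 3)) ≤ Real.exp 3 * Real.exp (-(L + 3)) := by gcongr
        _ = _ := by rw [← Real.exp_add]; ring_nf
    linarith

/-! ### Sums of independent variables and the conclusion -/

lemma MeasureTheory.MemLp.isStandardized_map {Ω : Type*} [MeasurableSpace Ω] {μ : Measure Ω}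
    [IsProbabilityMeasure μ] {X : Ω → ℝ} (hX : MemLp X 4 μ) (h1 : ∫ ω, X ω ∂μ = 0)
    (h2 : ∫ ω, X ω ^ 2 ∂μ = 1) : IsStandardized (μ.map X) where
  integrable_pow_four := by
    have hm := hX.1.aemeasurable
    rw [integrable_map_measure (by fun_prop) hm]
    have h : Integrable (fun ω => ‖X ω‖ ^ 4) μ := MemLp.integrable_norm_pow' (p := 4) hX
    refine h.congr (Filter.Eventually.of_forall fun ω => ?_)
    simp [(by decide : Even 4).pow_abs]
  mean_zero := by rwa [integral_map hX.1.aemeasurable (by fun_prop)]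
  variance_one := by rwa [integral_map hX.1.aemeasurable (by fun_prop)]

lemma charFun_map_sum_mul {Ω : Type*} [MeasurableSpace Ω] {μ : Measure Ω}
    [IsProbabilityMeasure μ] {ι : Type*} [Fintype ι] {X : ι → Ω → ℝ}
    (hX : ∀ j, AEMeasurable (X j) μ) (hind : iIndepFun X μ) (θ : ι → ℝ) (s : ℝ) :
    charFun (μ.map fun ω => ∑ j, θ j * X j ω) s = ∏ j, charFun (μ.map (X j)) (s * θ j) := by
  have h : iIndepFun (fun j ω => θ j * X j ω) μ :=
    hind.comp (fun j x => θ j * x) fun j => by fun_prop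
  rw [h.charFun_map_fun_sum_eq_prod fun j => (hX j).const_mul _, Finset.prod_apply]
  exact Finset.prod_congr rfl fun j _ => by rw [charFun_map_mul_comp (hX j), mul_comm]

lemma charFun_gaussianReal_zero_one (s : ℝ) :
    charFun (gaussianReal 0 1) s = (Real.exp (-s ^ 2 / 2) : ℝ) := by
  rw [charFun_gaussianReal]
  push_cast
  congr 1
  simp [neg_div]

lemma gaussianReal_real_Icc {a b : ℝ} (hab : a ≤ b) : (gaussianReal 0 1).real (Set.Icc a b) =
    1 / Real.sqrt (2 * Real.pi) * ∫ t in a..b, Real.exp (-t ^ 2 / 2) := by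
  rw [measureReal_def, gaussianReal_apply_eq_integral 0 one_ne_zero, ENNReal.toReal_ofReal
    (integral_nonneg fun x => gaussianPDFReal_nonneg _ _ _), integral_Icc_eq_integral_Ioc,
    ← intervalIntegral.integral_of_le hab, ← intervalIntegral.integral_const_mul]
  simp [gaussianPDFReal]

lemma gaussianReal_real_Icc_le {a b : ℝ} (hab : a ≤ b) :
    (gaussianReal 0 1).real (Set.Icc a b) ≤ b - a := by
  have h1 : 1 / Real.sqrt (2 * Real.pi) ≤ 1 := by
    rw [div_le_one (by positivity), Real.one_le_sqrt]
    nlinarith [Real.pi_gt_three]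
  have h2 : ∫ t in a..b, Real.exp (-t ^ 2 / 2) ≤ ∫ _t in a..b, (1 : ℝ) := by
    refine intervalIntegral.integral_mono hab (Continuous.intervalIntegrable (by fun_prop) _ _)
      (by simp) fun t => ?_
    exact Real.exp_le_one_iff.2 (by nlinarith [sq_nonneg t])
  have h3 : 0 ≤ ∫ t in a..b, Real.exp (-t ^ 2 / 2) :=
    intervalIntegral.integral_nonneg hab fun t _ => (Real.exp_pos _).le
  rw [gaussianReal_real_Icc hab]
  calc _ ≤ 1 * ∫ t in a..b, Real.exp (-t ^ 2 / 2) := by gcongr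
    _ ≤ _ := by simpa using h2

lemma exists_isRegularDirection_gaussian_bound {ε : ℝ} (hε : 0 < ε) (hε1 : ε ≤ 1) :
    ∃ C : ℝ, 0 < C ∧ ∀ {Ω : Type*} [MeasurableSpace Ω] (μ : Measure Ω) [IsProbabilityMeasure μ]
      (n : ℕ) (X : Fin n → Ω → ℝ), iIndepFun X μ → (∀ j, AEMeasurable (X j) μ) →
      (∀ j, IsStandardized (μ.map (X j))) → ∀ (U κ : ℝ), 1 ≤ U → 1 / U ≤ κ → κ ≤ 1 →
      ∀ θ : Fin n → ℝ, ∑ j, θ j ^ 2 = 1 →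
      IsRegularDirection (fun j => μ.map (X j)) (16 / ε) (ε / 16) U κ θ → ∀ a b, a < b →
        |(μ.map fun ω => ∑ j, θ j * X j ω).real (Set.Icc a b) -
          (gaussianReal 0 1).real (Set.Icc a b)| ≤ C * κ := by
  obtain ⟨C₁, hC₁, hsm⟩ := exists_smoothing_inequality
  have hA : 1 ≤ 16 / ε := by rw [le_div_iff₀ hε]; linarith
  obtain ⟨C₂, hC₂, hlin⟩ := exists_lintegral_prod_charFun_sub_le (16 / ε) (ε / 16) hA
    (by positivity) (by linarith)
  refine ⟨C₁ * (C₂ + 1), by positivity, ?_⟩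
  intro Ω _ μ _ n X hind hX hstd U κ hU hκ hκ1 θ hθ hreg a b hab
  have hprob : ∀ j, IsProbabilityMeasure (μ.map (X j)) := fun j =>
    Measure.isProbabilityMeasure_map (hX j)
  have hsum : AEMeasurable (fun ω => ∑ j, θ j * X j ω) μ :=
    Finset.aemeasurable_fun_sum _ fun j _ => (hX j).const_mul _
  have := Measure.isProbabilityMeasure_map hsum
  have hκ0 : 0 < κ := lt_of_lt_of_le (by positivity) hκ
  classical
  have key := hlin n (fun j => μ.map (X j)) hstd θ
    (Finset.univ.filter fun j => θ j ^ 2 * ∫ x, x ^ 4 ∂(μ.map (X j)) ≤ 16 / ε / U) U κ hU hκ hκ1 hθ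
    hreg.fourth hreg.third (fun j hj => (Finset.mem_filter.1 hj).2)
    (by
      rw [Finset.sum_filter]
      refine hreg.mass.trans_eq (Finset.sum_congr rfl fun j _ => ?_)
      simp [Set.indicator_apply])
    hreg.tail
  -- Smoothing at frequency `U` costs `1 / U ≤ κ`, the same order as the integral.
  refine (hsm (μ.map fun ω => ∑ j, θ j * X j ω) (gaussianReal 0 1)
    (fun a b hab => gaussianReal_real_Icc_le hab) U (C₂ * κ) (by linarith) (by positivity)
    ?_ a b hab).trans ?_
  · refine le_trans (le_of_eq ?_) key
    simp only [charFun_map_sum_mul hX hind, charFun_gaussianReal_zero_one]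
  · calc C₁ * (C₂ * κ + 1 / U) ≤ C₁ * (C₂ * κ + κ) := by gcongr
      _ = _ := by ring

lemma abs_sub_le_one_of_mem_Icc {x y : ℝ} (hx : x ∈ Set.Icc (0 : ℝ) 1)
    (hy : y ∈ Set.Icc (0 : ℝ) 1) : |x - y| ≤ 1 :=
  abs_le.2 ⟨by linarith [hx.1, hy.2], by linarith [hx.2, hy.1]⟩

theorem theorem1 :
    ∃ C : ℝ, 0 < C ∧ ∃ K : ℝ → ℝ,
      (∀ ρ : ℝ, 0 < ρ → ρ < 1 → K ρ ≤ C * max 1 (Real.log (1 / ρ) ^ 2)) ∧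
      ∀ (n : ℕ) (ρ : ℝ), 1 ≤ n → 0 < ρ → ρ < 1 →
        ∀ {Ω : Type*} [MeasurableSpace Ω] (μ : Measure Ω) [IsProbabilityMeasure μ]
          (X : Fin n → Ω → ℝ) (δ : ℝ),
          iIndepFun X μ →
          (∀ j, MemLp (X j) 4 μ) →
          (∀ j, ∫ ω, X j ω ∂μ = 0) →
          (∀ j, ∫ ω, X j ω ^ 2 ∂μ = 1) →
          δ ^ 4 = (1 / (n : ℝ)) * ∑ j, ∫ ω, X j ω ^ 4 ∂μ →
          ∃ F : Set (UnitSphere n), MeasurableSet F ∧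
            ENNReal.ofReal (1 - ρ) ≤ sphereUniform n F ∧
            ∀ θ ∈ F, ∀ α β : ℝ, α < β →
              |μ.real {ω | α ≤ ∑ j, θ.1 j * X j ω ∧ ∑ j, θ.1 j * X j ω ≤ β} -
                  1 / Real.sqrt (2 * Real.pi) * ∫ t in α..β, Real.exp (-t ^ 2 / 2)|
                ≤ K ρ * δ ^ 4 / n := by
  obtain ⟨ε, hε, hε1, C₁, hC₁, hdir⟩ := exists_sphereUniform_not_isRegularDirection_le
  obtain ⟨C₂, hC₂, hbound⟩ := exists_isRegularDirection_gaussian_bound hε hε1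
  set B : ℝ := 260000 / ε ^ 2 with hB
  have hB1 : 1 ≤ B := by
    rw [hB, le_div_iff₀ (by positivity)]
    nlinarith
  -- `C₁` serves the estimate on the sphere, `B` ensures `κ ≤ 1`, and `C₂ * B` is the constant of
  -- the final bound.
  set C := max (max C₁ B) (C₂ * B) with hC
  have hCC₁ : C₁ ≤ C := (le_max_left _ _).trans (le_max_left _ _)
  have hCB : B ≤ C := (le_max_right _ _).trans (le_max_left _ _)
  have hCC₂ : C₂ * B ≤ C := le_max_right _ _
  have hC0 : 0 < C := by linarith
  refine ⟨C, hC0, fun ρ => C * max 1 (Real.log (1 / ρ) ^ 2), fun _ _ _ => le_rfl, ?_⟩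
  intro n ρ hn hρ hρ1 Ω _ μ _ X δ hind hLp hmean hvar hδ
  have : NeZero n := ⟨by lia⟩
  have hn0 : (0 : ℝ) < n := by exact_mod_cast hn
  have hX : ∀ j, AEMeasurable (X j) μ := fun j => (hLp j).1.aemeasurable
  have hprob : ∀ j, IsProbabilityMeasure (μ.map (X j)) := fun j =>
    Measure.isProbabilityMeasure_map (hX j)
  have hstd : ∀ j, IsStandardized (μ.map (X j)) := fun j =>
    (hLp j).isStandardized_map (hmean j) (hvar j)
  set S := ∑ j, ∫ x, x ^ 4 ∂(μ.map (X j)) with hS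
  have hδS : δ ^ 4 = 1 / n * S := by
    rw [hδ, hS]
    congr 1
    exact Finset.sum_congr rfl fun j _ =>
      (integral_map (f := fun x : ℝ => x ^ 4) (hX j) (by fun_prop)).symm
  have hnS : (n : ℝ) ≤ S := by
    calc (n : ℝ) = ∑ _j : Fin n, (1 : ℝ) := by simp
      _ ≤ _ := Finset.sum_le_sum fun j _ => (hstd j).one_le_fourth_moment
  have hS0 : 0 < S := by linarith
  set U : ℝ := n ^ 2 / S with hU
  have hU0 : 0 < U := by positivity
  have hδU : δ ^ 4 / n = 1 / U := by
    rw [hδS, hU]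
    field_simp
  set L := max 1 (Real.log (1 / ρ)) with hL
  have hL1 : 1 ≤ L := le_max_left _ _
  have hLsq : L ^ 2 = max 1 (Real.log (1 / ρ) ^ 2) := by
    have hlog : 0 ≤ Real.log (1 / ρ) := Real.log_nonneg (by rw [le_div_iff₀ hρ]; linarith)
    rcases le_total 1 (Real.log (1 / ρ)) with h | h
    · rw [hL, max_eq_right h, max_eq_right (by nlinarith)]
    · rw [hL, max_eq_left h, max_eq_left (by nlinarith), one_pow]
  have hLρ : Real.exp (-L) ≤ ρ := by
    calc Real.exp (-L) ≤ Real.exp (-Real.log (1 / ρ)) :=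
          Real.exp_le_exp.2 (neg_le_neg (le_max_right _ _))
      _ = ρ := by rw [one_div, Real.log_inv, neg_neg, Real.exp_log hρ]
  have hK : C * max 1 (Real.log (1 / ρ) ^ 2) * δ ^ 4 / n = C * L ^ 2 / U := by
    rw [mul_div_assoc, hδU, hLsq, mul_one_div]
  have hset : ∀ (θ : UnitSphere n) (α β : ℝ),
      μ.real {ω | α ≤ ∑ j, θ.1 j * X j ω ∧ ∑ j, θ.1 j * X j ω ≤ β} =
        (μ.map fun ω => ∑ j, θ.1 j * X j ω).real (Set.Icc α β) := by
    intro θ α β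
    rw [measureReal_def, measureReal_def, Measure.map_apply_of_aemeasurable
      (Finset.aemeasurable_fun_sum _ fun j _ => (hX j).const_mul _) measurableSet_Icc]
    rfl
  have := isProbabilityMeasure_sphereUniform (n := n)
  -- For small `U` the claimed bound exceeds one, so every direction is admissible.
  rcases lt_or_ge U (C * L ^ 2) with hUL | hUL
  · refine ⟨Set.univ, .univ, ?_, fun θ _ α β hαβ => ?_⟩
    · rw [measure_univ]
      exact ENNReal.ofReal_le_one.2 (by linarith)
    · rw [hK, ← gaussianReal_real_Icc hαβ.le]
      refine (abs_sub_le_one_of_mem_Icc ⟨measureReal_nonneg, measureReal_le_one⟩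
        ⟨measureReal_nonneg, measureReal_le_one⟩).trans ?_
      rw [le_div_iff₀ hU0]
      linarith
  · have hLL : L ≤ L ^ 2 := by nlinarith
    have hU1 : 1 ≤ U := by nlinarith
    have hκ : 1 / U ≤ B * L ^ 2 / U := by
      gcongr
      nlinarith
    have hκ1 : B * L ^ 2 / U ≤ 1 := by
      rw [div_le_one hU0]
      exact le_trans (by gcongr) hUL
    have hmeas : MeasurableSet {θ : UnitSphere n | IsRegularDirection (fun j => μ.map (X j))
        (16 / ε) (ε / 16) U (B * L ^ 2 / U) θ.1} :=
      (measurableSet_isRegularDirection (fun j => μ.map (X j)) (16 / ε) (ε / 16) U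
        (B * L ^ 2 / U)).preimage (f := fun θ : UnitSphere n => θ.1.ofLp) (by fun_prop)
    refine ⟨_, hmeas, ?_, fun θ hθ α β hαβ => ?_⟩
    · have h := hdir n hn (fun j => μ.map (X j)) hstd U L hU hL1 (le_trans (by gcongr) hUL)
      have hc := prob_compl_eq_one_sub (μ := sphereUniform n) hmeas.compl
      rw [compl_compl] at hc
      rw [hc, ENNReal.ofReal_sub _ hρ.le, ENNReal.ofReal_one]
      exact tsub_le_tsub_left (h.trans (ENNReal.ofReal_le_ofReal hLρ)) _
    · have hθ1 : ∑ j, θ.1 j ^ 2 = 1 := by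
        rw [← EuclideanSpace.real_norm_sq_eq, norm_eq_of_mem_sphere θ, one_pow]
      rw [hK, hset, ← gaussianReal_real_Icc hαβ.le]
      refine (hbound μ n X hind hX hstd U _ hU1 hκ hκ1 θ.1 hθ1 hθ α β hαβ).trans ?_
      calc C₂ * (B * L ^ 2 / U) = C₂ * B * L ^ 2 / U := by ring
        _ ≤ _ := by gcongr
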